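/- Let $d,\ell\ge 1$, $\mathcal S=\{1,\dots,d\}$, and let $U\subset\mathbb R^\ell$ be compact with positive Lebesgue measure. For each $u\in U$ let $q^u$ be a rate matrix on $\mathcal S$ ($q^u_{ij}\ge 0$ for $j\ne i$, $q^u_{ii}=-\sum_{j\neq i}q^u_{ij}$), with $i$-th row $q^u_i$. Let $f:[0,\infty)\times\mathcal S\times U\to\mathbb R$, and let $\delta:[0,\infty)\to[0,1]$ be nonincreasing with $\delta(0)=1$. A regular relaxed control is a family $\pi=(\pi(i))_{i\in\mathcal S}$ of probability densities on $U$ with differential entropy $\mathcal H(\pi(i))=-\int_U \ln(\pi(i)(u))\,\pi(i)(u)\,du>-\infty$; their set is $\Pi_r$. Under $\pi\in\Pi_r$ the process $X$ is the continuous-time Markov chain whose rate matrix has the entries $\int_U q^u_{ij}\,\pi(i)(u)\,du$. Write $f^{\rho}(t,i)=\int_U f(t,i,u)\rho(u)\,du$. For $\lambda>0$, the entropy-regularized value is $$\widetilde J^\pi_\lambda(i)=\mathbb E_i\Big[\int_0^\infty\big(f^{\pi(X_s)}(s,X_s)+\lambda\,\delta(s)\,\mathcal H(\pi(X_s))\big)\,ds\Big],\qquad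 i\in\mathcal S,$$ and, for $\pi',\pi\in\Pi_r$ and $\varepsilon>0$, $\widetilde J^{\pi'\otimes_\varepsilon\pi}_\lambda(i)$ is the analogous value when $\pi'$ is used (for the dynamics and for the reward) on $[0,\varepsilon)$ and $\pi$ on $[\varepsilon,\infty)$. One calls $\pi\in\Pi_r$ a relaxed equilibrium if $$\limsup_{\varepsilon\downarrow0}\frac{\widetilde J^{\pi'\otimes_\varepsilon\pi}_\lambda(i)-\widetilde J^{\pi}_\lambda(i)}{\varepsilon}\le 0\qquad\text{for all }\pi'\in\Pi_r,\ i\in\mathcal S.$$ For $y\in\mathbb R^d$ and $i\in\mathcal S$ define the density $$\widetilde\Gamma_\lambda(y,i)(u)=\frac{e^{\frac1\lambda(f(0,i,u)+q^u_i\cdot y)}}{\int_U e^{\frac1\lambda(f(0,i,v)+q^v_i\cdot y)}\,dv},\quad u\in U,\qquad\text{and}\qquad \widetilde\Psi_\lambda(y)=\big(\widetilde J_\lambda^{\widetilde\Gamma_\lambda(y,\cdot)}(i)\big)_{i\in\mathcal S}\in\mathbb R^d .$$ **Theorem.** Assume that 1. $\int_0^\infty\big(\sup_{i\in\mathcal S,u\in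 U}|f(s,i,u)|+\delta(s)\big)\,ds<\infty$; 2. $u\mapsto f(t,i,u)$ and $u\mapsto q^u_i$ are Lipschitz on $U$, uniformly in $(t,i)\in[0,\infty)\times\mathcal S$; 3. (uniform cone condition) there are $\vartheta>0$ and $\iota\in(0,\pi/2]$ such that for every $u\in U$ there is a unit vector $e\in\mathbb R^\ell$ with $\{v\in\mathbb R^\ell:\ |v-u|<\vartheta,\ (v-u)\cdot e\ge|v-u|\cos\iota\}\subseteq U$; 4. $t\mapsto f(t,i,u)$, for all $i\in\mathcal S$ and $u\in U$, and $t\mapsto\delta(t)$ are continuous on $[0,\infty)$. Then, for every $\lambda>0$, there exists $y\in\mathbb R^d$ with $\widetilde\Psi_\lambda(y)=y$. Moreover, for every such $y$, $\widetilde\Gamma_\lambda(y,\cdot)$ belongs to $\Pi_r$ and is a relaxed equilibrium. -/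

import Mathlib

open MeasureTheory ProbabilityTheory Filter Topology
open scoped ENNReal

/-- `Q` is a rate matrix (generator) on the finite state space `Fin d`. -/
def IsRateMatrix {d : ℕ} (Q : Matrix (Fin d) (Fin d) ℝ) : Prop :=
  (∀ i j, j ≠ i → 0 ≤ Q i j) ∧ ∀ i, Q i i = -∑ j ∈ Finset.univ.erase i, Q i j

namespace RateMatrix

variable {d : ℕ}

/-- The jump rates out of state `i`. -/
noncomputable def jumpWeight (Q : Matrix (Fin d) (Fin d) ℝ) (i j : Fin d) : ℝ≥0∞ :=
  if j = i then 0 else ENNReal.ofReal (Q i j)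

theorem tsum_jumpWeight_ne_top (Q : Matrix (Fin d) (Fin d) ℝ) (i : Fin d) :
    ∑' j, jumpWeight Q i j ≠ ∞ := by
  rw [tsum_fintype]
  refine ENNReal.sum_ne_top.2 fun j _ => ?_
  unfold jumpWeight
  split_ifs
  · exact ENNReal.zero_ne_top
  · exact ENNReal.ofReal_ne_top

open Classical in
/-- The law of the next state when the chain leaves `i`: for a rate matrix `Q` with `Q i i ≠ 0`,
the state `j ≠ i` has probability `-Q i j / Q i i`. (An absorbing state is never left.) -/
noncomputable def jumpLaw (Q : Matrix (Fin d) (Fin d) ℝ) (i : Fin d) : PMF (Fin d) :=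
  if h : ∑' j, jumpWeight Q i j ≠ 0 then
    PMF.normalize (jumpWeight Q i) h (tsum_jumpWeight_ne_top Q i)
  else PMF.pure i

/-- The randomness that drives a chain: for each `n`, a number `(ω n).1` from which the `n`-th
holding time is made, and for each state `i` the state `(ω n).2 i` that is entered next if the
`n`-th jump leaves `i`. -/
abbrev Noise (d : ℕ) : Type := ℕ → ℝ × (Fin d → Fin d)

/-- The law of the randomness: all components are independent, `(ω n).1` is exponential with
parameter one, and `(ω n).2 i` has law `jumpLaw Q i`. -/
noncomputable def noiseLaw (Q : Matrix (Fin d) (Fin d) ℝ) : Measure (Noise d) :=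
  Measure.infinitePi fun _ : ℕ =>
    (expMeasure 1).prod (Measure.pi fun i : Fin d => (jumpLaw Q i).toMeasure)

/-- The successive states of the chain started in `i`. -/
def jumpChain (i : Fin d) (ω : Noise d) : ℕ → Fin d
  | 0 => i
  | n + 1 => (ω n).2 (jumpChain i ω n)

/-- The jump times of the chain started in `i`: the holding time in state `k` is a standard
exponential variable divided by `-Q k k`, hence exponential with parameter `-Q k k`
(and `∞` if `Q k k = 0`). -/
noncomputable def jumpTime (Q : Matrix (Fin d) (Fin d) ℝ) (i : Fin d) (ω : Noise d) : ℕ → ℝ≥0∞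
  | 0 => 0
  | n + 1 => jumpTime Q i ω n +
      ENNReal.ofReal (ω n).1 / ENNReal.ofReal (-Q (jumpChain i ω n) (jumpChain i ω n))

open Classical in
/-- The continuous-time Markov chain with rate matrix `Q` started in `i`: at time `t` it is in the
`n`-th state if `t` lies between the `n`-th and the `(n+1)`-st jump time. (The value `i` is
a convention on the null event that infinitely many jumps occur by time `t`.) -/
noncomputable def chain (Q : Matrix (Fin d) (Fin d) ℝ) (i : Fin d) (t : ℝ) (ω : Noise d) : Fin d :=
  if h : ∃ n, ENNReal.ofReal t < jumpTime Q i ω (n + 1) then jumpChain i ω (Nat.find h) else i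

end RateMatrix

/-- A cone in `ℝ^ℓ` with vertex `u`, axis pointing in the direction of the unit vector `e`,
and angle `ι` between the axis and the boundary. -/
def coneAt {ℓ : ℕ} (u e : EuclideanSpace ℝ (Fin ℓ)) (ι : ℝ) : Set (EuclideanSpace ℝ (Fin ℓ)) :=
  {v | Real.cos ι * ‖v - u‖ ≤ inner ℝ (v - u) e}

/-- The uniform cone condition. In dimension one it says that one of the intervals `(u - θ, u]`,
`[u, u + θ)` is contained in `U`, for every `u ∈ U`. -/
def UniformConeCondition {ℓ : ℕ} (U : Set (EuclideanSpace ℝ (Fin ℓ))) : Prop :=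
  ∃ θ > 0, ∃ ι : ℝ, 0 < ι ∧ ι ≤ Real.pi / 2 ∧
    ∀ u ∈ U, ∃ e : EuclideanSpace ℝ (Fin ℓ), ‖e‖ = 1 ∧ coneAt u e ι ∩ Metric.ball u θ ⊆ U

/-- The data of a controlled continuous-time chain on `d` states with actions in `ℝ^ℓ`: the action
space `U`, the rate matrices `q u` (for `u ∈ U`), the reward `f t i u` (for `t ≥ 0` and `u ∈ U`),
and the discount function `δ t` (for `t ≥ 0`). Values for other arguments play no role. -/
structure ControlledChain (d ℓ : ℕ) where
  U : Set (EuclideanSpace ℝ (Fin ℓ))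
  q : EuclideanSpace ℝ (Fin ℓ) → Matrix (Fin d) (Fin d) ℝ
  f : ℝ → Fin d → EuclideanSpace ℝ (Fin ℓ) → ℝ
  δ : ℝ → ℝ

namespace ControlledChain

open RateMatrix

variable {d ℓ : ℕ} (M : ControlledChain d ℓ)

/-- `ρ` is a probability density on the action space. -/
def IsDensity (ρ : EuclideanSpace ℝ (Fin ℓ) → ℝ) : Prop :=
  IntegrableOn ρ M.U ∧ (∀ u ∈ M.U, 0 ≤ ρ u) ∧ ∫ u in M.U, ρ u = 1

/-- The Shannon differential entropy of a density. -/
noncomputable def entropy (ρ : EuclideanSpace ℝ (Fin ℓ) → ℝ) : ℝ :=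
  -∫ u in M.U, Real.log (ρ u) * ρ u

/-- A regular relaxed feedback control, given by the densities of its values: each of them has
entropy greater than `-∞`. As `ρ log ρ` is bounded below and `U` has finite volume, this means
that `ρ log ρ` is integrable on `U`. -/
def IsRegular (π : Fin d → EuclideanSpace ℝ (Fin ℓ) → ℝ) : Prop :=
  ∀ i, M.IsDensity (π i) ∧ IntegrableOn (fun u => Real.log (π i u) * π i u) M.U

/-- The relaxed reward: the mean of `f t i` under the density `ρ`. -/
noncomputable def relaxedReward (ρ : EuclideanSpace ℝ (Fin ℓ) → ℝ) (t : ℝ) (i : Fin d) : ℝ :=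
  ∫ u in M.U, M.f t i u * ρ u

/-- The rate matrix induced by a regular relaxed control: row `i` is the mean of the `i`-th row of
`q u` under the density `π i`. -/
noncomputable def relaxedRate (π : Fin d → EuclideanSpace ℝ (Fin ℓ) → ℝ) :
    Matrix (Fin d) (Fin d) ℝ :=
  fun i j => ∫ u in M.U, M.q u i j * π i u

/-- The expected entropy-regularized reward over `[0, ∞)` of a process `X` defined on a probability
space `(Ω, P)`, when the relaxed control `π s` is in force at time `s`. -/
noncomputable def expectedReward {Ω : Type*} [MeasurableSpace Ω] (lam : ℝ) (P : Measure Ω)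
    (X : ℝ → Ω → Fin d) (π : ℝ → Fin d → EuclideanSpace ℝ (Fin ℓ) → ℝ) : ℝ :=
  ∫ ω, (∫ s in Set.Ioi (0 : ℝ),
    (M.relaxedReward (π s (X s ω)) s (X s ω) + lam * M.δ s * M.entropy (π s (X s ω)))) ∂P

/-- The value function of the entropy-regularized problem. -/
noncomputable def value (lam : ℝ) (π : Fin d → EuclideanSpace ℝ (Fin ℓ) → ℝ) (i : Fin d) : ℝ :=
  M.expectedReward lam (noiseLaw (M.relaxedRate π)) (chain (M.relaxedRate π) i) fun _ => π

/-- The chain governed by `π'` on `[0, ε)` and, from the state reached at time `ε` on, by `π`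
(driven by independent randomness). -/
noncomputable def concatChain (π' π : Fin d → EuclideanSpace ℝ (Fin ℓ) → ℝ) (ε : ℝ) (i : Fin d)
    (t : ℝ) (ω : Noise d × Noise d) : Fin d :=
  if t < ε then chain (M.relaxedRate π') i t ω.1
  else chain (M.relaxedRate π) (chain (M.relaxedRate π') i ε ω.1) (t - ε) ω.2

/-- The value of using `π'` on `[0, ε)` and `π` on `[ε, ∞)`. -/
noncomputable def concatValue (lam : ℝ) (π' π : Fin d → EuclideanSpace ℝ (Fin ℓ) → ℝ) (ε : ℝ)
    (i : Fin d) : ℝ :=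
  M.expectedReward lam ((noiseLaw (M.relaxedRate π')).prod (noiseLaw (M.relaxedRate π)))
    (M.concatChain π' π ε i) fun s => if s < ε then π' else π

/-- `π` is a relaxed equilibrium of the entropy-regularized problem. -/
def IsRelaxedEquilibrium (lam : ℝ) (π : Fin d → EuclideanSpace ℝ (Fin ℓ) → ℝ) : Prop :=
  M.IsRegular π ∧ ∀ π', M.IsRegular π' → ∀ i,
    limsup (fun ε : ℝ => (((M.concatValue lam π' π ε i - M.value lam π i) / ε : ℝ) : EReal))
      (𝓝[>] 0) ≤ 0

/-- The Gibbs density `Γ̃_λ(y, i)`. -/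
noncomputable def gibbs (lam : ℝ) (y : Fin d → ℝ) (i : Fin d) (u : EuclideanSpace ℝ (Fin ℓ)) : ℝ :=
  Real.exp (1 / lam * (M.f 0 i u + M.q u i ⬝ᵥ y)) /
    ∫ v in M.U, Real.exp (1 / lam * (M.f 0 i v + M.q v i ⬝ᵥ y))

/-- The operator `Ψ̃_λ`. -/
noncomputable def psi (lam : ℝ) (y : Fin d → ℝ) : Fin d → ℝ :=
  M.value lam (M.gibbs lam y)

/-- The standing assumptions on the data. -/
structure IsAdmissible : Prop where
  isCompact : IsCompact M.U
  volume_pos : 0 < volume M.U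
  rate : ∀ u ∈ M.U, IsRateMatrix (M.q u)
  discount_zero : M.δ 0 = 1
  discount_nonneg : ∀ t, 0 ≤ t → 0 ≤ M.δ t
  discount_antitone : AntitoneOn M.δ (Set.Ici 0)

/-- The total supremum of the reward and the total discount are finite. -/
def IntegrabilityCondition : Prop :=
  ∫⁻ s in Set.Ioi (0 : ℝ),
    ((⨆ i, ⨆ u ∈ M.U, ENNReal.ofReal |M.f s i u|) + ENNReal.ofReal (M.δ s)) < ∞

/-- The rewards and the rows of the rate matrices are Lipschitz in the action, uniformly in time
and in the state. -/
def LipschitzCondition : Prop :=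
  ∃ Θ : ℝ, ∀ t, 0 ≤ t → ∀ i, ∀ u ∈ M.U, ∀ v ∈ M.U,
    |M.f t i u - M.f t i v| + ‖WithLp.toLp 2 (M.q u i - M.q v i)‖ ≤ Θ * ‖u - v‖

end ControlledChain

/-! If the chain is controlled by `π'` on `[0, ε)` and by `π` afterwards, the gain over `π` has a
one-sided derivative at `ε = 0`: the difference of the running rewards at time zero plus the
difference of the generators applied to the value of `π` (`tendsto_concatValue_sub_value_div`). If
that value is `y`, then, because `δ 0 = 1`, each control contributes to this derivative `λ` times
the mean of the Gibbs exponent plus the entropy. By Gibbs' variational inequality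
(`integral_mul_add_entropy_le`) the Gibbs density maximizes this quantity, so the derivative is at
most zero whenever `π` is the Gibbs control of `y` and `y` is its own value. This gives the
equilibrium property.

Existence of a fixed point is Brouwer's theorem for a continuous map of sublinear growth
(`exists_fixedPoint_of_isLittleO`). Transition probabilities are bounded by one and the rewards have
an integrable bound, so `psi lam y` is controlled by the entropies of the Gibbs densities alone
(`exists_abs_psi_le`). The Gibbs exponent is Lipschitz in the action with a constant linear in
`‖y‖`, so it stays near its maximum on a ball of radius of order `1 / (1 + ‖y‖)`. The cone condition
keeps a fixed proportion of that ball inside `U`, and the entropy therefore grows at most like `ℓ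
log (1 + ‖y‖)` (`exists_abs_entropy_gibbs_le`).

Both halves need values written analytically. The pathwise chain has transition matrix `exp (t Q)`
(`noiseLaw_chain_eq`): both sides solve the renewal equation at the first jump, whose bounded
solution is unique, and the rows of the exponential sum to one, which excludes explosion. Fubini
then turns values into time integrals. -/

section Brouwer

/-! ### Brouwer's fixed point theorem, by a weighted Milnor–Rogers argument -/

variable {E : Type*} [NormedAddCommGroup E] [InnerProductSpace ℝ E] [FiniteDimensional ℝ E]

open Polynomial in
theorem exists_polynomial_eval_eq_det_one_add_smul (A : E →L[ℝ] E) :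
    ∃ p : ℝ[X], p.natDegree ≤ Module.finrank ℝ E ∧ ∀ t : ℝ, p.eval t = (1 + t • A).det := by
  classical
  let b := Module.finBasis ℝ E
  let m := LinearMap.toMatrix b b (A : E →ₗ[ℝ] E)
  refine ⟨((X : ℝ[X]) • m.map C + (1 : Matrix _ _ ℝ).map C).det, ?_, fun t => ?_⟩
  · simpa using natDegree_det_X_add_C_le m 1
  · rw [ContinuousLinearMap.det, ← LinearMap.det_toMatrix b, ← coe_evalRingHom, RingHom.map_det]
    congr 1
    ext i j
    simp only [m, RingHom.mapMatrix_apply, Matrix.map_apply, Matrix.add_apply, Matrix.smul_apply,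
      smul_eq_mul, coe_evalRingHom, eval_mul, eval_X, eval_C,
      ContinuousLinearMap.toLinearMap_add, ContinuousLinearMap.toLinearMap_smul, map_add, map_smul]
    rw [add_comm]
    congr 1
    exact congrFun (congrFun (LinearMap.toMatrix_one b).symm i) j

/-- The weight involves only the squared norm, which is quadratic in `t`. The degree bound does not
depend on `A`, `x`, `v`, so one set of interpolation nodes will serve all points at once. -/
theorem exists_polynomial_eval_eq_comp_mul_det (A : E →L[ℝ] E) (x v : E) (M : ℝ) (n : ℕ) :
    ∃ p : Polynomial ℝ, p.natDegree ≤ n * 2 + Module.finrank ℝ E ∧ ∀ t : ℝ,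
      p.eval t = (1 - ‖x + t • v‖ ^ 2 / M ^ 2) ^ n * (1 + t • A).det := by
  obtain ⟨p, hp, hpe⟩ := exists_polynomial_eval_eq_det_one_add_smul A
  let a : Polynomial ℝ := Polynomial.C (-(‖v‖ ^ 2 / M ^ 2)) * Polynomial.X ^ 2 +
    Polynomial.C (-(2 * inner ℝ x v / M ^ 2)) * Polynomial.X +
    Polynomial.C (1 - ‖x‖ ^ 2 / M ^ 2)
  refine ⟨a ^ n * p, ?_, fun t => ?_⟩
  · refine Polynomial.natDegree_mul_le.trans (add_le_add ?_ hp)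
    exact Polynomial.natDegree_pow_le.trans (Nat.mul_le_mul_left n Polynomial.natDegree_quadratic_le)
  · simp only [a, Polynomial.eval_mul, Polynomial.eval_pow, Polynomial.eval_add, Polynomial.eval_C,
      Polynomial.eval_X, hpe]
    rw [norm_add_sq_real, norm_smul, inner_smul_right, mul_pow, Real.norm_eq_abs, sq_abs]
    ring

/-- For `s ≤ t` the operator `s A` has norm below one, so `1 + s A` is injective. The determinant
starts at one and never vanishes, hence keeps its sign. -/
theorem det_one_add_smul_pos {A : E →L[ℝ] E} {K t : ℝ} (hA : ‖A‖ ≤ K) (ht : 0 ≤ t)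
    (htK : t * K < 1) : 0 < (1 + t • A).det := by
  have hne : ∀ s ∈ Set.Icc 0 t, (1 + s • A).det ≠ 0 := by
    intro s hs h0
    obtain ⟨x, hx, hx0⟩ := Submodule.exists_mem_ne_zero_of_ne_bot
      (LinearMap.bot_lt_ker_of_det_eq_zero h0).ne'
    have hx' : x = -(s • A x) := eq_neg_of_add_eq_zero_left (by simpa using hx)
    have hxn : 0 < ‖x‖ := norm_pos_iff.2 hx0
    have hK : 0 ≤ K := (norm_nonneg A).trans hA
    have : ‖x‖ ≤ t * K * ‖x‖ := by
      calc ‖x‖ = s * ‖A x‖ := by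
            conv_lhs => rw [hx', norm_neg, norm_smul, Real.norm_eq_abs, abs_of_nonneg hs.1]
        _ ≤ t * (K * ‖x‖) := mul_le_mul hs.2 (A.le_of_opNorm_le hA x) (norm_nonneg _) ht
        _ = _ := by ring
    nlinarith
  by_contra hneg
  push Not at hneg
  obtain ⟨p, -, hp⟩ := exists_polynomial_eval_eq_det_one_add_smul A
  have hc : ContinuousOn (fun s : ℝ => (1 + s • A).det) (Set.Icc 0 t) := by
    simp_rw [← hp]; exact p.continuous.continuousOn
  have h1 : (1 + (0 : ℝ) • A).det = 1 := by
    rw [zero_smul, add_zero]; exact LinearMap.det_id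
  obtain ⟨s, hs, hs0⟩ := intermediate_value_Icc' ht hc (show (0 : ℝ) ∈ _ from ⟨hneg, by rw [h1]; exact zero_le_one⟩)
  exact hne s hs hs0

/-- The preimages of `y` are the fixed points of the contraction `x ↦ y - t g x`. -/
theorem bijective_id_add_smul {g : E → E} {K : NNReal} (hg : LipschitzWith K g) {t : ℝ}
    (ht : 0 ≤ t) (htK : t * K < 1) : Function.Bijective fun x => x + t • g x := by
  have hcon : ∀ y, ContractingWith (t.toNNReal * K) fun x => y - t • g x := by
    intro y
    refine ⟨?_, ?_⟩
    · rw [← NNReal.coe_lt_coe]; simpa [ht] using htK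
    · refine LipschitzWith.of_dist_le_mul fun a b => ?_
      rw [dist_sub_left, dist_smul₀]
      have := hg.dist_le_mul a b
      simp only [NNReal.coe_mul, Real.coe_toNNReal t ht, Real.norm_eq_abs, abs_of_nonneg ht]
      rw [mul_assoc]; gcongr
  refine ⟨fun x z h => ?_, fun y => ?_⟩
  · refine (hcon (x + t • g x)).fixedPoint_unique' (x := x) (y := z) ?_ ?_
    · simp [Function.IsFixedPt]
    · simp only at h
      simp [Function.IsFixedPt, h]
  · refine ⟨ContractingWith.fixedPoint _ (hcon y), ?_⟩
    have h := (hcon y).fixedPoint_isFixedPt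
    exact (sub_eq_iff_eq_add.1 h).symm

variable [MeasurableSpace E] [BorelSpace E]

/-- For small `t` the map `x ↦ x + t g x` is a bijection of the space that is the identity off `B`,
so it permutes `B`. This is the change of variables formula, with a positive Jacobian. -/
theorem setIntegral_comp_id_add_smul_mul_det {g : E → E} {K : NNReal} (hg : ContDiff ℝ 1 g)
    (hK : LipschitzWith K g) {B : Set E} (hB : MeasurableSet B) (hgB : ∀ x ∉ B, g x = 0)
    {t : ℝ} (ht : 0 ≤ t) (htK : t * K < 1) (φ : E → ℝ) :
    ∫ x in B, φ (x + t • g x) * (1 + t • fderiv ℝ g x).det = ∫ x in B, φ x := by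
  obtain ⟨hinj, hsurj⟩ := bijective_id_add_smul hK ht htK
  have himg : (fun x => x + t • g x) '' B = B := by
    ext y
    constructor
    · rintro ⟨x, hx, rfl⟩
      by_contra hy
      have : x + t • g x = x := hinj (by simpa using Or.inr (hgB _ hy))
      exact hy (by simpa only [this] using hx)
    · intro hy
      obtain ⟨x, hx⟩ := hsurj y
      refine ⟨x, ?_, hx⟩
      by_contra hxB
      simp only [hgB x hxB, smul_zero, add_zero] at hx
      exact hxB (hx ▸ hy)
  have hd : ∀ x ∈ B, HasFDerivWithinAt (fun x => x + t • g x) (1 + t • fderiv ℝ g x) B x := by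
    intro x _
    exact ((hasFDerivAt_id x).add
      (((hg.differentiable one_ne_zero) x).hasFDerivAt.const_smul t)).hasFDerivWithinAt
  have := integral_image_eq_integral_abs_det_fderiv_smul (volume : Measure E) hB hd hinj.injOn φ
  rw [himg] at this
  rw [this]
  refine setIntegral_congr_fun hB fun x _ => ?_
  have hpos : 0 < (1 + t • fderiv ℝ g x).det :=
    det_one_add_smul_pos (norm_fderiv_le_of_lipschitz ℝ hK) ht htK
  simp only [abs_of_pos hpos, smul_eq_mul, mul_comm]

/-- With `t g` in place of `g`, the left side is polynomial in `t`. By change of variables it is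
constant for small `t`, hence also at `t = 1`, where the map need no longer be bijective. -/
theorem setIntegral_one_sub_norm_sq_pow_mul_det {g : E → E} (hg : ContDiff ℝ 1 g) {R : ℝ}
    (hgB : ∀ x ∉ Metric.closedBall (0 : E) R, g x = 0) (M : ℝ) (n : ℕ) :
    ∫ x in Metric.closedBall (0 : E) R,
        (1 - ‖x + g x‖ ^ 2 / M ^ 2) ^ n * (1 + fderiv ℝ g x).det =
      ∫ x in Metric.closedBall (0 : E) R, (1 - ‖x‖ ^ 2 / M ^ 2) ^ n := by
  set B := Metric.closedBall (0 : E) R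
  obtain ⟨K, hK⟩ := hg.lipschitzWith_of_hasCompactSupport
    (HasCompactSupport.intro (isCompact_closedBall 0 R) hgB) one_ne_zero
  set N := n * 2 + Module.finrank ℝ E + 1
  have hKN : 0 < (K + 1 : ℝ) * N := by positivity
  -- There are more nodes than the degree of the integrand in `t`, and for `j < N` each satisfies
  -- `node j * K < 1`, as the change of variables requires.
  let node : ℕ → ℝ := fun j => j / ((K + 1) * N)
  have hnode : Set.InjOn node (Finset.range N) := by
    intro i _ j _ h
    simpa [node, div_left_inj' hKN.ne'] using h
  let F : ℝ → E → ℝ := fun t x =>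
    (1 - ‖x + t • g x‖ ^ 2 / M ^ 2) ^ n * (1 + t • fderiv ℝ g x).det
  have hFcont : ∀ t, Continuous (F t) := fun t => by
    have h1 : Continuous fun x => 1 + t • fderiv ℝ g x :=
      continuous_const.add ((hg.continuous_fderiv one_ne_zero).const_smul t)
    have h2 := hg.continuous
    exact ((continuous_const.sub (((continuous_id.add (h2.const_smul t)).norm.pow 2).div_const _)).pow
      n).mul (ContinuousLinearMap.continuous_det.comp h1)
  have hFint : ∀ t, IntegrableOn (F t) B := fun t =>
    (hFcont t).continuousOn.integrableOn_compact (isCompact_closedBall 0 R)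
  have hinterp : ∀ x t, F t x = ∑ j ∈ Finset.range N,
      F (node j) x * (Lagrange.basis (Finset.range N) node j).eval t := by
    intro x t
    obtain ⟨p, hp, hpe⟩ := exists_polynomial_eval_eq_comp_mul_det (fderiv ℝ g x) x (g x) M n
    have hdeg : p.degree < (Finset.range N).card := by
      rw [Finset.card_range]
      exact Polynomial.degree_le_natDegree.trans_lt (by exact_mod_cast Nat.lt_succ_of_le hp)
    have := congrArg (Polynomial.eval t) (Lagrange.eq_interpolate hnode hdeg)
    rw [Lagrange.interpolate_apply, Polynomial.eval_finsetSum] at this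
    simpa [hpe] using this
  have hconst : ∀ j ∈ Finset.range N, ∫ x in B, F (node j) x =
      ∫ x in B, (1 - ‖x‖ ^ 2 / M ^ 2) ^ n := by
    intro j hj
    refine setIntegral_comp_id_add_smul_mul_det hg hK Metric.isClosed_closedBall.measurableSet hgB
      (by positivity) ?_ fun y => (1 - ‖y‖ ^ 2 / M ^ 2) ^ n
    have hjN : (j : ℝ) < N := by exact_mod_cast Finset.mem_range.1 hj
    have hK0 : (0 : ℝ) ≤ K := K.2
    rw [div_mul_eq_mul_div, div_lt_one hKN]
    nlinarith [Nat.cast_nonneg (α := ℝ) j]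
  have hF1 : ∀ x, (1 - ‖x + g x‖ ^ 2 / M ^ 2) ^ n * (1 + fderiv ℝ g x).det = F 1 x := by
    intro x; simp [F]
  simp_rw [hF1, hinterp _ 1]
  rw [integral_finsetSum _ fun j _ => (hFint _).mul_const _]
  simp_rw [integral_mul_const]
  -- All nodes give the same integral, and the Lagrange basis sums to one.
  rw [Finset.sum_congr rfl fun j hj => by rw [hconst j hj], ← Finset.mul_sum,
    ← Polynomial.eval_finsetSum, Lagrange.sum_basis hnode ⟨0, by simp [N]⟩]
  simp

/-- Without a zero, `‖x + g x‖ ≥ c > 0` on the ball, so the transformed integral is `O((1 - c² / M²)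
^ n)`. The untransformed one is at least a positive multiple of `(1 - (c / 2)² / M²) ^ n`, from the
ball of radius `c / 2`. They are equal for every `n`, which is impossible for large `n`. -/
theorem exists_add_eq_zero_of_contDiff {g : E → E} (hg : ContDiff ℝ 1 g) {R : ℝ} (hR : 0 < R)
    (hgB : ∀ x ∉ Metric.closedBall (0 : E) R, g x = 0) : ∃ x, x + g x = 0 := by
  by_contra! hne
  set B := Metric.closedBall (0 : E) R
  have hBc : IsCompact B := isCompact_closedBall 0 R
  have hB0 : (0 : E) ∈ B := by simp [B, hR.le]
  have hfc : Continuous fun x => ‖x + g x‖ := (continuous_id.add hg.continuous).norm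
  obtain ⟨x₀, -, hmin⟩ := hBc.exists_isMinOn ⟨0, hB0⟩ hfc.continuousOn
  obtain ⟨x₁, -, hmax⟩ := hBc.exists_isMaxOn ⟨0, hB0⟩ hfc.continuousOn
  obtain ⟨c, hc, hcR, hcm⟩ : ∃ c > 0, c ≤ R ∧ ∀ x ∈ B, c ≤ ‖x + g x‖ :=
    ⟨min R ‖x₀ + g x₀‖, lt_min hR (norm_pos_iff.2 (hne _)), min_le_left _ _,
      fun x hx => (min_le_right _ _).trans (hmin hx)⟩
  obtain ⟨M, hMR, hMm⟩ : ∃ M ≥ R, ∀ x ∈ B, ‖x + g x‖ ≤ M :=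
    ⟨max R ‖x₁ + g x₁‖, le_max_left _ _, fun x hx => (hmax hx).trans (le_max_right _ _)⟩
  have hM : 0 < M := hR.trans_le hMR
  have hdc : Continuous fun x => (1 + fderiv ℝ g x).det :=
    ContinuousLinearMap.continuous_det.comp
      (continuous_const.add (hg.continuous_fderiv one_ne_zero))
  obtain ⟨D, hD⟩ := hBc.exists_bound_of_continuousOn hdc.continuousOn
  set a := 1 - c ^ 2 / M ^ 2 with ha
  set b := 1 - (c / 2) ^ 2 / M ^ 2 with hb
  have ha0 : 0 ≤ a := by
    rw [ha, sub_nonneg, div_le_one (by positivity)]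
    gcongr; exact hcR.trans hMR
  have hab : a < b := by
    rw [ha, hb]; gcongr; linarith
  set v := (volume : Measure E).real (Metric.ball 0 (c / 2))
  set V := (volume : Measure E).real B
  have hv : 0 < v := ENNReal.toReal_pos (Metric.measure_ball_pos _ _ (by positivity)).ne'
    measure_ball_lt_top.ne
  have key : ∀ n : ℕ, b ^ n * v ≤ a ^ n * D * V := by
    intro n
    have h1 : ‖∫ x in B, (1 - ‖x + g x‖ ^ 2 / M ^ 2) ^ n * (1 + fderiv ℝ g x).det‖ ≤
        a ^ n * D * V := by
      refine norm_setIntegral_le_of_norm_le_const hBc.measure_lt_top fun x hx => ?_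
      have h3 : 0 ≤ 1 - ‖x + g x‖ ^ 2 / M ^ 2 := by
        rw [sub_nonneg, div_le_one (by positivity)]
        gcongr; exact hMm x hx
      rw [norm_mul, norm_pow, Real.norm_eq_abs, abs_of_nonneg h3]
      gcongr
      · rw [ha]; gcongr; exact hcm x hx
      · exact hD x hx
    have hcont : Continuous fun x : E => (1 - ‖x‖ ^ 2 / M ^ 2) ^ n := by fun_prop
    have hint : IntegrableOn (fun x : E => (1 - ‖x‖ ^ 2 / M ^ 2) ^ n) B :=
      hcont.continuousOn.integrableOn_compact hBc
    have hsub : Metric.ball (0 : E) (c / 2) ⊆ B :=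
      (Metric.ball_subset_ball (by linarith)).trans Metric.ball_subset_closedBall
    have h2 : b ^ n * v ≤ ∫ x in B, (1 - ‖x‖ ^ 2 / M ^ 2) ^ n := by
      calc b ^ n * v = ∫ _ in Metric.ball (0 : E) (c / 2), b ^ n := by
            simp [v, mul_comm]
        _ ≤ ∫ x in Metric.ball (0 : E) (c / 2), (1 - ‖x‖ ^ 2 / M ^ 2) ^ n := by
            refine setIntegral_mono_on (integrableOn_const measure_ball_lt_top.ne) (hint.mono_set hsub)
              measurableSet_ball fun x hx => ?_
            have hx' : ‖x‖ < c / 2 := by simpa using hx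
            refine pow_le_pow_left₀ (ha0.trans hab.le) ?_ n
            rw [hb]; gcongr
        _ ≤ _ := by
            refine setIntegral_mono_set hint ?_ hsub.eventuallyLE
            filter_upwards [ae_restrict_mem hBc.measurableSet] with x hx
            refine pow_nonneg ?_ n
            rw [sub_nonneg, div_le_one (by positivity)]
            gcongr; exact (mem_closedBall_zero_iff.1 hx).trans hMR
    rw [← setIntegral_one_sub_norm_sq_pow_mul_det hg hgB M n] at h2
    exact h2.trans ((le_abs_self _).trans h1)
  have hb0 : 0 < b := ha0.trans_lt hab
  have hlim : Tendsto (fun n : ℕ => (a / b) ^ n * (D * V)) atTop (𝓝 (0 * (D * V))) :=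
    (tendsto_pow_atTop_nhds_zero_of_lt_one (by positivity) ((div_lt_one hb0).2 hab)).mul_const _
  rw [zero_mul] at hlim
  obtain ⟨n, hn⟩ := (hlim.eventually_lt_const hv).exists
  have := key n
  rw [div_pow, div_mul_eq_mul_div, div_lt_iff₀ (by positivity)] at hn
  linarith

-- If the minimum of `‖x + g x‖` over the ball were positive, a `C¹` approximation of `g` closer
-- than this minimum, with no larger support, would have a zero of `x + g' x` in the ball, where `‖x
-- + g x‖` would then lie below the minimum.
omit [MeasurableSpace E] [BorelSpace E] in
theorem exists_add_eq_zero_of_continuous {g : E → E} (hg : Continuous g) {R : ℝ} (hR : 0 < R)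
    (hgB : ∀ x ∉ Metric.closedBall (0 : E) R, g x = 0) : ∃ x, x + g x = 0 := by
  borelize E
  obtain ⟨x₀, -, hmin⟩ := (isCompact_closedBall (0 : E) R).exists_isMinOn
    ⟨0, by simp [hR.le]⟩ (continuous_id.add hg).norm.continuousOn
  refine ⟨x₀, ?_⟩
  by_contra hne
  obtain ⟨g', hg', happrox, hsupp⟩ := hg.exists_contDiff_approx (n := 1)
    (continuous_const (y := ‖x₀ + g x₀‖)) fun _ => norm_pos_iff.2 hne
  obtain ⟨x, hx⟩ := exists_add_eq_zero_of_contDiff (R := R) hg' hR fun x hx => by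
    by_contra h
    exact hsupp h (hgB x hx)
  have hxB : x ∈ Metric.closedBall (0 : E) R := by
    by_contra h
    have h0 : g' x = 0 := by
      by_contra h'
      exact hsupp h' (hgB x h)
    rw [h0, add_zero] at hx
    rw [hx] at h
    exact h (by simp [hR.le])
  have h1 := happrox x
  have h2 : ‖x₀ + g x₀‖ ≤ ‖x + g x‖ := hmin hxB
  have h3 : x + g x = -(g' x - g x) := by
    rw [neg_sub, ← sub_eq_zero, ← hx]; abel
  rw [dist_eq_norm] at h1
  rw [h3, norm_neg] at h2
  linarith

omit [MeasurableSpace E] [BorelSpace E] in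
/-- A form of Brouwer's fixed point theorem. -/
theorem exists_fixedPoint_of_norm_lt {h : E → E} (hh : Continuous h) {R : ℝ} (hR : 0 < R)
    (hlt : ∀ x, R ≤ ‖x‖ → ‖h x‖ < ‖x‖) : ∃ x, h x = x := by
  -- This cutoff is one on the ball of radius `R` and zero outside that of radius `2 R`. A solution
  -- of `x = χ x • h x` has `‖x‖ ≤ ‖h x‖`, hence `‖x‖ < R` and `χ x = 1`.
  let χ : E → ℝ := fun x => max 0 (min 1 (2 - ‖x‖ / R))
  have hχ : Continuous χ := by fun_prop
  obtain ⟨x, hx⟩ := exists_add_eq_zero_of_continuous (g := fun x => -(χ x • h x))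
    (hχ.smul hh).neg (R := 2 * R) (by positivity) fun x hx => by
      have h2 : 2 ≤ ‖x‖ / R := by
        rw [le_div_iff₀ hR]
        simpa using (not_le.1 (mt mem_closedBall_zero_iff.2 hx)).le
      have : χ x = 0 := max_eq_left ((min_le_right _ _).trans (by linarith))
      simp [this]
  have hx' : x = χ x • h x := by rwa [← sub_eq_add_neg, sub_eq_zero] at hx
  have hχ0 : 0 ≤ χ x := le_max_left _ _
  have hχ1 : χ x ≤ 1 := max_le zero_le_one (min_le_left _ _)
  have hle : ‖x‖ ≤ ‖h x‖ := by
    calc ‖x‖ = χ x * ‖h x‖ := by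
          conv_lhs => rw [hx', norm_smul, Real.norm_eq_abs, abs_of_nonneg hχ0]
      _ ≤ 1 * ‖h x‖ := by gcongr
      _ = _ := one_mul _
  have hxR : ‖x‖ < R := by
    by_contra hge
    exact (hlt x (not_lt.1 hge)).not_ge hle
  have : χ x = 1 := by
    have : ‖x‖ / R ≤ 1 := (div_le_one hR).2 hxR.le
    simp only [χ]
    rw [min_eq_left (by linarith), max_eq_right zero_le_one]
  refine ⟨x, ?_⟩
  rw [this, one_smul] at hx'
  exact hx'.symm

end Brouwer

/-- The problem moves from the sup norm to the Euclidean norm; sublinear growth survives a change to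
an equivalent norm. -/
theorem exists_fixedPoint_of_isLittleO {d : ℕ} {h : (Fin d → ℝ) → Fin d → ℝ} (hh : Continuous h)
    (ho : h =o[Bornology.cobounded _] fun y => y) : ∃ y, h y = y := by
  let e := EuclideanSpace.equiv (Fin d) ℝ
  have ho' : (fun x => e.symm (h (e x))) =o[Bornology.cobounded _] fun x => x :=
    ((e.symm.isBigO_comp _ _).trans_isLittleO
      (ho.comp_tendsto e.antilipschitz.tendsto_cobounded)).trans_isBigO 
      ((e : EuclideanSpace ℝ (Fin d) →L[ℝ] Fin d → ℝ).isBigO_id _)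
  have h1 := ho'.def (c := 1 / 2) (by norm_num)
  obtain ⟨r, hr⟩ := (Metric.hasBasis_cobounded_compl_closedBall (0 : EuclideanSpace ℝ (Fin d))).mem_iff.1
    h1
  obtain ⟨x, hx⟩ := exists_fixedPoint_of_norm_lt (h := fun x => e.symm (h (e x)))
    (R := max r 0 + 1) (e.symm.continuous.comp (hh.comp e.continuous)) (by positivity) fun x hx => by
      have hr0 : 0 ≤ max r 0 := le_max_right _ _
      have h2 : ‖e.symm (h (e x))‖ ≤ 1 / 2 * ‖x‖ := hr.2 (Set.mem_compl fun hx' => by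
        rw [mem_closedBall_zero_iff] at hx'
        linarith [le_max_left r 0])
      linarith
  refine ⟨e x, ?_⟩
  simpa using congrArg e hx

/-! ### The matrix exponential of a rate matrix -/

namespace RateMatrix

variable {d : ℕ}

open NormedSpace

section Exp

open scoped Matrix.Norms.Operator in
theorem hasDerivAt_exp_smul_apply (Q : Matrix (Fin d) (Fin d) ℝ) (i j : Fin d) (t : ℝ) :
    HasDerivAt (fun t : ℝ => exp (t • Q) i j) ((Q * exp (t • Q)) i j) t := by
  have h := hasDerivAt_exp_smul_const' (𝕂 := ℝ) Q t
  exact hasDerivAt_pi.1 (hasDerivAt_pi.1 h i) j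

open scoped Matrix.Norms.Operator in
theorem continuous_exp_matrix :
    Continuous (exp : Matrix (Fin d) (Fin d) ℝ → Matrix (Fin d) (Fin d) ℝ) :=
  exp_continuous

theorem exp_add_smul (Q : Matrix (Fin d) (Fin d) ℝ) (s t : ℝ) :
    exp ((s + t) • Q) = exp (s • Q) * exp (t • Q) := by
  rw [add_smul]
  exact Matrix.exp_add_of_commute _ _ (((Commute.refl Q).smul_left s).smul_right t)

theorem sum_exp_smul_apply {Q : Matrix (Fin d) (Fin d) ℝ} (hQ : IsRateMatrix Q) (i : Fin d)
    (t : ℝ) : ∑ j, exp (t • Q) i j = 1 := by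
  have hrow : ∀ k, ∑ j, Q k j = 0 := fun k => by
    rw [← Finset.add_sum_erase _ _ (Finset.mem_univ k), hQ.2 k]; ring
  have hcomm : ∀ s : ℝ, Q * exp (s • Q) = exp (s • Q) * Q := fun s =>
    (((Commute.refl Q).smul_right s).exp_right).eq
  have hd : ∀ s, HasDerivAt (fun s : ℝ => ∑ j, exp (s • Q) i j) 0 s := by
    intro s
    have h := HasDerivAt.fun_sum (u := Finset.univ) fun j _ => hasDerivAt_exp_smul_apply Q i j s
    refine h.congr_deriv ?_
    simp_rw [hcomm, Matrix.mul_apply]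
    rw [Finset.sum_comm]
    simp_rw [← Finset.mul_sum, hrow]
    simp
  have := is_const_of_deriv_eq_zero (fun s => (hd s).differentiableAt) (fun s => (hd s).deriv) t 0
  simpa [Matrix.one_apply] using this

end Exp

theorem neg_diag_nonneg {Q : Matrix (Fin d) (Fin d) ℝ} (hQ : IsRateMatrix Q) (i : Fin d) :
    0 ≤ -Q i i := by
  rw [hQ.2 i, neg_neg]
  exact Finset.sum_nonneg fun j hj => hQ.1 i j (Finset.ne_of_mem_erase hj)

theorem jumpLaw_apply_toReal {Q : Matrix (Fin d) (Fin d) ℝ} (hQ : IsRateMatrix Q) {i : Fin d}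
    (hi : 0 < -Q i i) (k : Fin d) :
    (jumpLaw Q i k).toReal = if k = i then 0 else Q i k / -Q i i := by
  have hsum : ∑' j, jumpWeight Q i j = ENNReal.ofReal (-Q i i) := by
    rw [tsum_fintype, hQ.2 i, neg_neg, ENNReal.ofReal_sum_of_nonneg fun j hj =>
      hQ.1 i j (Finset.ne_of_mem_erase hj), ← Finset.add_sum_erase _ _ (Finset.mem_univ i)]
    rw [jumpWeight, if_pos rfl, zero_add]
    exact Finset.sum_congr rfl fun j hj => if_neg (Finset.ne_of_mem_erase hj)
  have hne : ∑' j, jumpWeight Q i j ≠ 0 := by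
    rw [hsum]; simpa using hi
  rw [jumpLaw, dif_pos hne, PMF.normalize_apply, hsum, jumpWeight]
  split_ifs with h
  · simp
  · rw [ENNReal.toReal_mul, ENNReal.toReal_inv, ENNReal.toReal_ofReal (hQ.1 i k h),
      ENNReal.toReal_ofReal hi.le, div_eq_mul_inv]

theorem integral_expMeasure_one (g : ℝ → ℝ) :
    ∫ x, g x ∂expMeasure 1 = ∫ x in Set.Ioi (0 : ℝ), Real.exp (-x) * g x := by
  have h : expMeasure 1 = (volume.restrict (Set.Ioi (0 : ℝ))).withDensity
      fun x => ENNReal.ofReal (Real.exp (-x)) := by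
    rw [← withDensity_indicator measurableSet_Ioi]
    refine withDensity_congr_ae ?_
    filter_upwards [Measure.ae_ne volume 0] with x hx
    rw [show gammaPDF 1 1 x = exponentialPDF 1 x from rfl, exponentialPDF_eq]
    rcases lt_or_gt_of_ne hx with h | h
    · simp [h.not_ge, h.le]
    · simp [h, h.le]
  rw [h, integral_withDensity_eq_integral_toReal_smul (by fun_prop) (by simp)]
  simp [Real.exp_nonneg]

/-- First-step decomposition of the matrix exponential of a rate matrix. -/
theorem exp_smul_apply_eq_add_integral {Q : Matrix (Fin d) (Fin d) ℝ} (hQ : IsRateMatrix Q)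
    {i : Fin d} (hi : 0 < -Q i i) (j : Fin d) (t : ℝ) :
    exp (t • Q) i j = Real.exp (-(-Q i i * t)) * (if i = j then 1 else 0) +
      ∫ x in (0 : ℝ)..(-Q i i * t), Real.exp (-x) *
        ∑ k, (jumpLaw Q i k).toReal * exp ((t - x / -Q i i) • Q) k j := by
  set q := -Q i i with hq
  have hcont : ∀ k, Continuous fun s : ℝ => exp (s • Q) k j := fun k =>
    continuous_iff_continuousAt.2 fun s => (hasDerivAt_exp_smul_apply Q k j s).continuousAt
  -- Here `x` is `q` times the first holding time, so it matches a standard exponential variable.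
  -- Differentiating `Real.exp (-x)` cancels the diagonal entry of `Q`; the off-diagonal entries
  -- over `q` form the jump law.
  have hd : ∀ x, HasDerivAt (fun x => -(Real.exp (-x) * exp ((t - x / q) • Q) i j))
      (Real.exp (-x) * ∑ k, (jumpLaw Q i k).toReal * exp ((t - x / q) • Q) k j) x := by
    intro x
    have h1 : HasDerivAt (fun x : ℝ => t - x / q) (-(1 / q)) x :=
      ((hasDerivAt_id x).div_const q).const_sub t
    have h2 := (hasDerivAt_exp_smul_apply Q i j (t - x / q)).comp x h1
    have h3 : HasDerivAt (fun x : ℝ => Real.exp (-x)) (-Real.exp (-x)) x := by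
      simpa using (hasDerivAt_neg x).exp
    refine (h3.mul h2).neg.congr_deriv ?_
    rw [Matrix.mul_apply, ← Finset.add_sum_erase _ _ (Finset.mem_univ i),
      ← Finset.add_sum_erase _ (fun k => (jumpLaw Q i k).toReal * _) (Finset.mem_univ i)]
    have h4 : ∀ k ∈ Finset.univ.erase i, (jumpLaw Q i k).toReal * exp ((t - x / q) • Q) k j =
        1 / q * (Q i k * exp ((t - x / q) • Q) k j) := fun k hk => by
      rw [jumpLaw_apply_toReal hQ hi, if_neg (Finset.ne_of_mem_erase hk), ← hq]; ring
    rw [Finset.sum_congr rfl h4, ← Finset.mul_sum, jumpLaw_apply_toReal hQ hi, if_pos rfl]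
    have h5 : Q i i = -q := by rw [hq, neg_neg]
    simp only [h5, Function.comp]
    field_simp
    ring
  rw [intervalIntegral.integral_eq_sub_of_hasDerivAt (fun x _ => hd x)]
  · have : q * t / q = t := by field_simp
    simp [this, Matrix.one_apply]
  · refine Continuous.intervalIntegrable ?_ _ _
    refine (Real.continuous_exp.comp continuous_neg).mul (continuous_finsetSum _ fun k _ => ?_)
    exact continuous_const.mul ((hcont k).comp (by fun_prop))

theorem exp_smul_apply_of_diag_eq_zero {Q : Matrix (Fin d) (Fin d) ℝ} (hQ : IsRateMatrix Q)
    {i : Fin d} (hi : -Q i i = 0) (j : Fin d) (t : ℝ) :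
    exp (t • Q) i j = if i = j then 1 else 0 := by
  have hrow : ∀ k, Q i k = 0 := by
    have h := hQ.2 i
    rw [← neg_eq_iff_eq_neg, hi, eq_comm, Finset.sum_eq_zero_iff_of_nonneg fun k hk =>
      hQ.1 i k (Finset.ne_of_mem_erase hk)] at h
    intro k
    by_cases hk : k = i
    · subst hk; linarith
    · exact h k (Finset.mem_erase.2 ⟨hk, Finset.mem_univ k⟩)
  have hd : ∀ s, HasDerivAt (fun s : ℝ => exp (s • Q) i j) 0 s := by
    intro s
    have h := hasDerivAt_exp_smul_apply Q i j s
    rwa [Matrix.mul_apply, Finset.sum_eq_zero fun k _ => by rw [hrow k, zero_mul]] at h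
  have := is_const_of_deriv_eq_zero (fun s => (hd s).differentiableAt) (fun s => (hd s).deriv) t 0
  simpa [Matrix.one_apply] using this

end RateMatrix

/-! ### Splitting off the first term of an i.i.d. sequence -/

section NatCons

variable {X : Type*} [MeasurableSpace X]

theorem measurable_natCases :
    Measurable fun (p : X × (ℕ → X)) (n : ℕ) => Nat.casesOn (motive := fun _ => X) n p.1 p.2 := by
  refine measurable_pi_lambda _ fun n => ?_
  cases n with
  | zero => exact measurable_fst
  | succ n => exact (measurable_pi_apply n).comp measurable_snd

/-- Prepending an independent draw to an i.i.d. sequence reproduces its law. This is the source of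
the Markov property at the first jump. -/
theorem map_natCases_prod_infinitePi (ν : Measure X) [IsProbabilityMeasure ν] :
    (ν.prod (Measure.infinitePi fun _ : ℕ => ν)).map
      (fun p n => Nat.casesOn (motive := fun _ => X) n p.1 p.2) =
      Measure.infinitePi fun _ : ℕ => ν := by
  classical
  refine Measure.eq_infinitePi _ fun s t ht => ?_
  obtain ⟨N, hN⟩ := s.exists_nat_subset_range
  -- Padding with `Set.univ` turns the cylinder over `s` into one over an initial segment, on which
  -- the shift of indices is harmless.
  let t' : ℕ → Set X := fun i => if i ∈ s then t i else Set.univ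
  have ht' : ∀ i, MeasurableSet (t' i) := fun i => by
    by_cases h : i ∈ s
    · simpa [t', h] using ht i
    · simp [t', h]
  have hpre : (fun (p : X × (ℕ → X)) (n : ℕ) => Nat.casesOn (motive := fun _ => X) n p.1 p.2) ⁻¹'
      (Set.pi s t) = t' 0 ×ˢ Set.pi (Finset.range N) fun i => t' (i + 1) := by
    ext p
    simp only [Set.mem_preimage, Set.mem_pi, Set.mem_prod, Finset.mem_coe, Finset.mem_range]
    constructor
    · intro h
      refine ⟨?_, fun i _ => ?_⟩
      · by_cases h0 : 0 ∈ s
        · simpa [t', h0] using h 0 h0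
        · simp [t', h0]
      · by_cases h0 : i + 1 ∈ s
        · simpa [t', h0] using h (i + 1) h0
        · simp [t', h0]
    · rintro ⟨h0, h1⟩ i hi
      cases i with
      | zero => simpa [t', hi] using h0
      | succ i =>
        have := h1 i ((Nat.lt_succ_self i).trans (Finset.mem_range.1 (hN hi)))
        simpa [t', hi] using this
  have hprod : ∏ i ∈ s, ν (t i) = ∏ i ∈ Finset.range (N + 1), ν (t' i) := by
    rw [← Finset.prod_subset (hN.trans (Finset.range_mono N.le_succ)) fun i _ hi => by simp [t', hi]]
    exact Finset.prod_congr rfl fun i hi => by simp [t', hi]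
  rw [Measure.map_apply measurable_natCases (.pi s.countable_toSet fun i _ => ht i), hpre,
    Measure.prod_prod, Measure.infinitePi_pi _ fun i _ => ht' (i + 1), hprod,
    Finset.prod_range_succ', mul_comm]

end NatCons

/-! ### Transition probabilities of the pathwise chain -/

namespace RateMatrix

variable {d : ℕ}

theorem measurable_jumpChain (i : Fin d) (n : ℕ) : Measurable fun ω : Noise d => jumpChain i ω n := by
  induction n with
  | zero => exact measurable_const
  | succ n ih =>
    have h : Measurable fun p : (Fin d → Fin d) × Fin d => p.1 p.2 := measurable_of_countable _
    exact h.comp ((measurable_snd.comp (measurable_pi_apply n)).prodMk ih)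

theorem measurable_jumpTime (Q : Matrix (Fin d) (Fin d) ℝ) (i : Fin d) (n : ℕ) :
    Measurable fun ω : Noise d => jumpTime Q i ω n := by
  induction n with
  | zero => exact measurable_const
  | succ n ih =>
    refine ih.add (Measurable.div ?_ ?_)
    · exact (measurable_fst.comp (measurable_pi_apply n)).ennreal_ofReal
    · exact (measurable_of_countable fun k => ENNReal.ofReal (-Q k k)).comp
        (measurable_jumpChain i n)

/-- The event that the chain started in `i` is in its `n`-th state at time `t`, which is `j`. -/
def inStage (Q : Matrix (Fin d) (Fin d) ℝ) (i j : Fin d) (n : ℕ) (t : ℝ≥0∞) : Set (Noise d) :=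
  {ω | (∀ m < n, jumpTime Q i ω (m + 1) ≤ t) ∧ t < jumpTime Q i ω (n + 1) ∧ jumpChain i ω n = j}

/-- The event that the chain started in `i` has not exploded by time `t` and is in state `j`. -/
def settled (Q : Matrix (Fin d) (Fin d) ℝ) (i j : Fin d) (t : ℝ≥0∞) : Set (Noise d) :=
  ⋃ n, inStage Q i j n t

theorem measurableSet_settled_prod (Q : Matrix (Fin d) (Fin d) ℝ) (i j : Fin d) :
    MeasurableSet {p : ℝ≥0∞ × Noise d | p.2 ∈ settled Q i j p.1} := by
  have h : ∀ n, Measurable fun p : ℝ≥0∞ × Noise d => jumpTime Q i p.2 n := fun n =>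
    (measurable_jumpTime Q i n).comp measurable_snd
  have hset : {p : ℝ≥0∞ × Noise d | p.2 ∈ settled Q i j p.1} =
      ⋃ n, ({p : ℝ≥0∞ × Noise d | ∀ m < n, jumpTime Q i p.2 (m + 1) ≤ p.1} ∩
        ({p | p.1 < jumpTime Q i p.2 (n + 1)} ∩ {p | jumpChain i p.2 n = j})) := by
    ext p
    simp [settled, inStage]
  rw [hset]
  refine MeasurableSet.iUnion fun n => (MeasurableSet.inter ?_ (MeasurableSet.inter ?_ ?_))
  · simp only [Set.ofPred_forall]
    exact MeasurableSet.iInter fun m => MeasurableSet.iInter fun _ =>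
      measurableSet_le (h (m + 1)) measurable_fst
  · exact measurableSet_lt measurable_fst (h (n + 1))
  · exact ((measurable_jumpChain i n).comp measurable_snd) (measurableSet_singleton j)

theorem settled_subset_chain (Q : Matrix (Fin d) (Fin d) ℝ) (i j : Fin d) (t : ℝ) :
    settled Q i j (ENNReal.ofReal t) ⊆ {ω | chain Q i t ω = j} := by
  classical
  intro ω hω
  obtain ⟨n, hn, hn', hj⟩ := Set.mem_iUnion.1 hω
  have h : ∃ n, ENNReal.ofReal t < jumpTime Q i ω (n + 1) := ⟨n, hn'⟩
  have hfind : Nat.find h = n := (Nat.find_eq_iff h).2 ⟨hn', fun m hm => (hn m hm).not_gt⟩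
  rw [Set.mem_ofPred_eq, chain, dif_pos h]
  convert hj

theorem chain_mem_settled_or (Q : Matrix (Fin d) (Fin d) ℝ) (i : Fin d) (t : ℝ) (ω : Noise d) :
    ω ∈ settled Q i (chain Q i t ω) (ENNReal.ofReal t) ∨
      (chain Q i t ω = i ∧ ∀ k, ω ∉ settled Q i k (ENNReal.ofReal t)) := by
  classical
  unfold chain
  split_ifs with h
  · refine Or.inl (Set.mem_iUnion.2 ⟨Nat.find h, fun m hm => ?_, ?_, rfl⟩)
    · exact not_lt.1 (Nat.find_min h hm)
    · exact Nat.find_spec h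
  · refine Or.inr ⟨rfl, fun k hk => h ?_⟩
    obtain ⟨n, -, hn', -⟩ := Set.mem_iUnion.1 hk
    exact ⟨n, hn'⟩

theorem measurable_chain (Q : Matrix (Fin d) (Fin d) ℝ) (i : Fin d) :
    Measurable fun p : ℝ × Noise d => chain Q i p.1 p.2 := by
  have hS : ∀ j, MeasurableSet {p : ℝ × Noise d | p.2 ∈ settled Q i j (ENNReal.ofReal p.1)} :=
    fun j => (ENNReal.measurable_ofReal.comp measurable_fst).prodMk measurable_snd
      (measurableSet_settled_prod Q i j)
  refine measurable_to_countable' fun j => ?_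
  have : (fun p : ℝ × Noise d => chain Q i p.1 p.2) ⁻¹' {j} =
      {p : ℝ × Noise d | p.2 ∈ settled Q i j (ENNReal.ofReal p.1)} ∪
        ((⋂ k, {p : ℝ × Noise d | p.2 ∈ settled Q i k (ENNReal.ofReal p.1)}ᶜ) ∩ {_p | i = j}) := by
    ext p
    simp only [Set.mem_preimage, Set.mem_singleton_iff, Set.mem_union, Set.mem_ofPred_eq,
      Set.mem_inter_iff, Set.mem_iInter, Set.mem_compl_iff]
    constructor
    · rintro rfl
      rcases chain_mem_settled_or Q i p.1 p.2 with h | h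
      · exact Or.inl h
      · exact Or.inr ⟨h.2, h.1.symm⟩
    · rintro (h | ⟨h, rfl⟩)
      · exact settled_subset_chain Q i j p.1 h
      · rcases chain_mem_settled_or Q i p.1 p.2 with h' | h'
        · exact absurd h' (h _)
        · exact h'.1
  rw [this]
  exact (hS j).union ((MeasurableSet.iInter fun k => (hS k).compl).inter (.const _))

/-- The definition unfolds at the last jump; the renewal argument needs it unfolded at the first. -/
theorem jumpChain_succ' (i : Fin d) (ω : Noise d) (n : ℕ) :
    jumpChain i ω (n + 1) = jumpChain ((ω 0).2 i) (fun m => ω (m + 1)) n := by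
  induction n with
  | zero => rfl
  | succ n ih => rw [jumpChain, ih, jumpChain]

theorem jumpTime_succ' (Q : Matrix (Fin d) (Fin d) ℝ) (i : Fin d) (ω : Noise d) (n : ℕ) :
    jumpTime Q i ω (n + 1) = ENNReal.ofReal (ω 0).1 / ENNReal.ofReal (-Q i i) +
      jumpTime Q ((ω 0).2 i) (fun m => ω (m + 1)) n := by
  induction n with
  | zero => simp [jumpTime, jumpChain]
  | succ n ih => rw [jumpTime, ih, jumpTime, add_assoc, jumpChain_succ']

/-- Either the first holding time exceeds `t` and the chain still sits in `i`, or the shifted noise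
drives a fresh chain from the new state for the remaining time. -/
theorem mem_settled_iff (Q : Matrix (Fin d) (Fin d) ℝ) (i j : Fin d) {t : ℝ≥0∞} (ht : t ≠ ∞)
    (ω : Noise d) :
    ω ∈ settled Q i j t ↔
      (t < ENNReal.ofReal (ω 0).1 / ENNReal.ofReal (-Q i i) ∧ i = j) ∨
      (ENNReal.ofReal (ω 0).1 / ENNReal.ofReal (-Q i i) ≤ t ∧ (fun m => ω (m + 1)) ∈
        settled Q ((ω 0).2 i) j (t - ENNReal.ofReal (ω 0).1 / ENNReal.ofReal (-Q i i))) := by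
  set T := ENNReal.ofReal (ω 0).1 / ENNReal.ofReal (-Q i i) with hT
  have h1 : jumpTime Q i ω 1 = T := by simp [jumpTime, jumpChain, hT]
  have hle : ∀ S : ℝ≥0∞, T ≤ t → (T + S ≤ t ↔ S ≤ t - T) := fun S h =>
    (ENNReal.le_sub_iff_add_le_left (ne_top_of_le_ne_top ht h) h).symm
  have hlt : ∀ S : ℝ≥0∞, T ≤ t → (t < T + S ↔ t - T < S) := fun S h => by
    rw [← not_le, hle S h, not_le]
  simp only [settled, inStage, Set.mem_iUnion, Set.mem_ofPred_eq]
  constructor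
  · rintro ⟨n, hn, hn', hj⟩
    cases n with
    | zero => exact Or.inl ⟨h1 ▸ hn', hj⟩
    | succ n =>
      have hTt : T ≤ t := h1 ▸ hn 0 n.succ_pos
      refine Or.inr ⟨hTt, n, fun m hm => ?_, ?_, ?_⟩
      · rw [← hle _ hTt, ← jumpTime_succ']
        exact hn (m + 1) (by omega)
      · rwa [← hlt _ hTt, ← jumpTime_succ']
      · rwa [← jumpChain_succ']
  · rintro (⟨h, hj⟩ | ⟨hTt, n, hn, hn', hj⟩)
    · exact ⟨0, fun m hm => absurd hm m.not_lt_zero, by rwa [zero_add, h1], hj⟩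
    · refine ⟨n + 1, fun m hm => ?_, ?_, ?_⟩
      · cases m with
        | zero => rwa [zero_add, h1]
        | succ m => rw [jumpTime_succ', hle _ hTt]; exact hn m (by omega)
      · rwa [jumpTime_succ', hlt _ hTt]
      · rwa [jumpChain_succ']

instance isProbabilityMeasure_pi_jumpLaw (Q : Matrix (Fin d) (Fin d) ℝ) : IsProbabilityMeasure
    ((expMeasure 1).prod (Measure.pi fun i : Fin d => (jumpLaw Q i).toMeasure)) :=
  have := isProbabilityMeasure_expMeasure one_pos
  inferInstance

instance isProbabilityMeasure_noiseLaw (Q : Matrix (Fin d) (Fin d) ℝ) :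
    IsProbabilityMeasure (noiseLaw Q) := by
  unfold noiseLaw; infer_instance

theorem ae_expMeasure_pos : ∀ᵐ x ∂expMeasure 1, 0 < x := by
  have h : expMeasure 1 = volume.withDensity (exponentialPDF 1) := rfl
  rw [h, ae_withDensity_iff (by unfold exponentialPDF; fun_prop)]
  filter_upwards [Measure.ae_ne volume 0] with x hx h0
  by_contra hneg
  exact h0 (exponentialPDF_of_neg (lt_of_le_of_ne (not_lt.1 hneg) hx))

/-- The probability of `settled`. -/
noncomputable def settledProb (Q : Matrix (Fin d) (Fin d) ℝ) (i j : Fin d) (t : ℝ) : ℝ :=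
  (noiseLaw Q).real (settled Q i j (ENNReal.ofReal t))

theorem measurable_settledProb (Q : Matrix (Fin d) (Fin d) ℝ) (i j : Fin d) :
    Measurable (settledProb Q i j) := by
  have := measurable_measure_prodMk_left (ν := noiseLaw Q) (measurableSet_settled_prod Q i j)
  exact (this.comp ENNReal.measurable_ofReal).ennreal_toReal

theorem noiseLaw_settled (Q : Matrix (Fin d) (Fin d) ℝ) (i j : Fin d) (t : ℝ≥0∞) :
    noiseLaw Q (settled Q i j t) =
      ∫⁻ a, noiseLaw Q {ω | (fun n => Nat.casesOn (motive := fun _ => ℝ × (Fin d → Fin d)) n a ω) ∈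
        settled Q i j t} ∂((expMeasure 1).prod (Measure.pi fun i : Fin d => (jumpLaw Q i).toMeasure)) := by
  have hm : MeasurableSet (settled Q i j t) := measurable_prodMk_left (measurableSet_settled_prod Q i j)
  conv_lhs => rw [noiseLaw, ← map_natCases_prod_infinitePi,
    Measure.map_apply measurable_natCases hm, Measure.prod_apply (measurable_natCases hm)]
  rfl

theorem noiseLaw_natCases_mem_settled (Q : Matrix (Fin d) (Fin d) ℝ) (i j : Fin d) {t : ℝ≥0∞}
    (ht : t ≠ ∞) (a : ℝ × (Fin d → Fin d)) :
    noiseLaw Q {ω | (fun n => Nat.casesOn (motive := fun _ => ℝ × (Fin d → Fin d)) n a ω) ∈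
      settled Q i j t} =
    if t < ENNReal.ofReal a.1 / ENNReal.ofReal (-Q i i) then (if i = j then 1 else 0) else
      noiseLaw Q (settled Q (a.2 i) j (t - ENNReal.ofReal a.1 / ENNReal.ofReal (-Q i i))) := by
  set A := {ω | (fun n => Nat.casesOn (motive := fun _ => ℝ × (Fin d → Fin d)) n a ω) ∈
    settled Q i j t}
  set T := ENNReal.ofReal a.1 / ENNReal.ofReal (-Q i i)
  have hA : ∀ ω : Noise d, ω ∈ A ↔ (t < T ∧ i = j) ∨ (T ≤ t ∧ ω ∈ settled Q (a.2 i) j (t - T)) :=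
    fun ω => mem_settled_iff Q i j ht _
  split_ifs with h h'
  · rw [Set.eq_univ_of_forall fun ω => (hA ω).2 (Or.inl ⟨h, h'⟩), measure_univ]
  · have hA0 : A = ∅ := Set.eq_empty_of_forall_notMem fun ω hω =>
      ((hA ω).1 hω).elim (fun h1 => h' h1.2) fun h1 => h1.1.not_gt h
    rw [hA0, measure_empty]
  · congr 1
    ext ω
    exact (hA ω).trans
      ⟨fun h1 => (h1.resolve_left fun h2 => h h2.1).2, fun h1 => Or.inr ⟨not_lt.1 h, h1⟩⟩

theorem settledProb_of_diag_eq_zero {Q : Matrix (Fin d) (Fin d) ℝ} {i : Fin d} (hi : -Q i i = 0)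
    (j : Fin d) (t : ℝ) : settledProb Q i j t = if i = j then 1 else 0 := by
  have : ∀ᵐ a ∂((expMeasure 1).prod (Measure.pi fun i : Fin d => (jumpLaw Q i).toMeasure)),
      noiseLaw Q {ω | (fun n => Nat.casesOn (motive := fun _ => ℝ × (Fin d → Fin d)) n a ω) ∈
        settled Q i j (ENNReal.ofReal t)} = if i = j then 1 else 0 := by
    filter_upwards [Measure.quasiMeasurePreserving_fst.ae ae_expMeasure_pos] with a ha
    -- Positivity of the draw matters: in `ℝ≥0∞` a nonzero number divided by zero is `∞`, but `0 / 0
    -- = 0`.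
    rw [noiseLaw_natCases_mem_settled Q i j ENNReal.ofReal_ne_top, hi, ENNReal.ofReal_zero,
      ENNReal.div_zero (ENNReal.ofReal_pos.2 ha).ne', if_pos ENNReal.ofReal_lt_top]
  rw [settledProb, measureReal_def, noiseLaw_settled, lintegral_congr_ae this]
  split_ifs <;> simp

/-- Conditioning on the first noise coordinate; of its jump vector only component `i` matters, and
this has law `jumpLaw Q i`. -/
theorem settledProb_eq_integral {Q : Matrix (Fin d) (Fin d) ℝ} {i : Fin d} (hi : 0 < -Q i i)
    (j : Fin d) {t : ℝ} (ht : 0 ≤ t) :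
    settledProb Q i j t = ∫ x, ∑ k, (jumpLaw Q i k).toReal *
      (if t < x / -Q i i then (if i = j then 1 else 0) else
        settledProb Q k j (t - x / -Q i i)) ∂expMeasure 1 := by
  have := isProbabilityMeasure_expMeasure one_pos
  set q := -Q i i with hq
  let G : ℝ × Fin d → ℝ := fun p => if t < p.1 / q then (if i = j then 1 else 0) else
    settledProb Q p.2 j (t - p.1 / q)
  have hGm : Measurable G := by
    refine Measurable.ite (measurableSet_lt measurable_const (measurable_fst.div_const q))
      measurable_const ?_
    exact measurable_from_prod_countable_left fun k =>
      (measurable_settledProb Q k j).comp (measurable_const.sub (measurable_id.div_const q))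
  have hGint : Integrable G ((expMeasure 1).prod (jumpLaw Q i).toMeasure) := by
    refine Integrable.of_bound hGm.aestronglyMeasurable 1 (Eventually.of_forall fun p => ?_)
    simp only [G]
    split_ifs
    · simp
    · simp
    · rw [Real.norm_eq_abs, settledProb, abs_of_nonneg measureReal_nonneg]
      exact measureReal_le_one
  have hmp : MeasurePreserving (Prod.map id (Function.eval i))
      ((expMeasure 1).prod (Measure.pi fun i : Fin d => (jumpLaw Q i).toMeasure))
      ((expMeasure 1).prod (jumpLaw Q i).toMeasure) :=
    (MeasurePreserving.id _).prod (measurePreserving_eval _ i)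
  have hae : ∀ᵐ a ∂((expMeasure 1).prod (Measure.pi fun i : Fin d => (jumpLaw Q i).toMeasure)),
      noiseLaw Q {ω | (fun n => Nat.casesOn (motive := fun _ => ℝ × (Fin d → Fin d)) n a ω) ∈
        settled Q i j (ENNReal.ofReal t)} = ENNReal.ofReal (G (Prod.map id (Function.eval i) a)) := by
    filter_upwards [Measure.quasiMeasurePreserving_fst.ae ae_expMeasure_pos] with a ha
    rw [noiseLaw_natCases_mem_settled Q i j ENNReal.ofReal_ne_top, ← hq,
      ← ENNReal.ofReal_div_of_pos hi, ← ENNReal.ofReal_sub _ (by positivity)]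
    simp only [G, Prod.map_fst, id, Prod.map_snd, Function.eval,
      ENNReal.ofReal_lt_ofReal_iff_of_nonneg ht]
    split_ifs with h h'
    · simp
    · simp
    · rw [settledProb, ofReal_measureReal]
  rw [settledProb, measureReal_def, noiseLaw_settled, lintegral_congr_ae hae,
    ← integral_eq_lintegral_of_nonneg_ae]
  · rw [← integral_map hmp.measurable.aemeasurable hGm.aestronglyMeasurable, hmp.map_eq,
      integral_prod _ hGint]
    simp_rw [PMF.integral_eq_sum, G, smul_eq_mul]
  · refine Eventually.of_forall fun a => ?_
    simp only [G, Pi.zero_apply]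
    split_ifs
    · simp
    · simp
    · exact measureReal_nonneg
  · exact (hGm.comp hmp.measurable).aestronglyMeasurable

/-- The part `x > q t` of the exponential integral is the event of no jump by time `t`. The result
is the equation that `exp_smul_apply_eq_add_integral` gives for the exponential. -/
theorem settledProb_eq_add_integral {Q : Matrix (Fin d) (Fin d) ℝ} {i : Fin d} (hi : 0 < -Q i i)
    (j : Fin d) {t : ℝ} (ht : 0 ≤ t) :
    settledProb Q i j t = Real.exp (-(-Q i i * t)) * (if i = j then 1 else 0) +
      ∫ x in (0 : ℝ)..(-Q i i * t), Real.exp (-x) *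
        ∑ k, (jumpLaw Q i k).toReal * settledProb Q k j (t - x / -Q i i) := by
  have := isProbabilityMeasure_expMeasure one_pos
  set q := -Q i i with hq
  have hqt : 0 ≤ q * t := by positivity
  have hJ : ∑ k, (jumpLaw Q i k).toReal = 1 := by
    rw [← ENNReal.toReal_sum fun k _ => (jumpLaw Q i).apply_ne_top k, ← tsum_fintype (L := SummationFilter.unconditional _),
      (jumpLaw Q i).tsum_coe, ENNReal.toReal_one]
  rw [settledProb_eq_integral hi j ht, integral_expMeasure_one, ← hq,
    ← Set.Ioc_union_Ioi_eq_Ioi hqt]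
  have hcase : ∀ x, t < x / q ↔ q * t < x := fun x => by rw [lt_div_iff₀ hi, mul_comm]
  have hexp : IntegrableOn (fun x : ℝ => Real.exp (-x)) (Set.Ioi 0) := integrableOn_exp_neg_Ioi 0
  have hS : ∀ k s, |settledProb Q k j s| ≤ 1 := fun k s => by
    rw [settledProb, abs_of_nonneg measureReal_nonneg]; exact measureReal_le_one
  have hint : IntegrableOn (fun x => Real.exp (-x) * ∑ k, (jumpLaw Q i k).toReal *
      (if t < x / q then (if i = j then 1 else 0) else settledProb Q k j (t - x / q)))
      (Set.Ioi 0) := by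
    simp_rw [Finset.mul_sum]
    refine integrable_finsetSum _ fun k _ => ?_
    simp_rw [mul_left_comm (Real.exp _)]
    refine (Integrable.mul_bdd (c := 1) hexp ?_ (Eventually.of_forall fun x => ?_)).const_mul _
    · exact (Measurable.ite (measurableSet_lt measurable_const (measurable_id.div_const q))
        measurable_const ((measurable_settledProb Q k j).comp
          (measurable_const.sub (measurable_id.div_const q)))).aestronglyMeasurable
    · split_ifs
      · simp
      · simp
      · exact hS k _
  rw [setIntegral_union Set.Ioc_disjoint_Ioi_same measurableSet_Ioi
    (hint.mono_set Set.Ioc_subset_Ioi_self) (hint.mono_set (Set.Ioi_subset_Ioi hqt)), add_comm]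
  congr 1
  · rw [setIntegral_congr_fun (g := fun x => Real.exp (-x) * if i = j then 1 else 0)
      measurableSet_Ioi, integral_mul_const, integral_exp_neg_Ioi]
    intro x hx
    simp only [hcase, if_pos (Set.mem_Ioi.1 hx), ← Finset.sum_mul, hJ, one_mul]
  · rw [intervalIntegral.integral_of_le hqt]
    refine setIntegral_congr_fun measurableSet_Ioc fun x hx => ?_
    simp only [hcase, if_neg hx.2.not_gt]

/-- The difference of two solutions of the renewal equation is bounded on `[0, T]`, and each use of
the equation shrinks its bound by a factor `θ < 1`. -/
theorem settledProb_eq_exp_smul_apply {Q : Matrix (Fin d) (Fin d) ℝ} (hQ : IsRateMatrix Q) (j : Fin d) {T : ℝ} :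
    ∀ i, ∀ t ∈ Set.Icc 0 T, settledProb Q i j t = NormedSpace.exp (t • Q) i j := by
  set D : Fin d → ℝ → ℝ := fun i t => settledProb Q i j t - NormedSpace.exp (t • Q) i j with hD
  have hcont : ∀ k, Continuous fun s : ℝ => NormedSpace.exp (s • Q) k j := fun k =>
    continuous_iff_continuousAt.2 fun s => (hasDerivAt_exp_smul_apply Q k j s).continuousAt
  have hS : ∀ k s, |settledProb Q k j s| ≤ 1 := fun k s => by
    rw [settledProb, abs_of_nonneg measureReal_nonneg]; exact measureReal_le_one
  choose C hC using fun k =>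
    (isCompact_Icc (a := 0) (b := T)).exists_bound_of_continuousOn (hcont k).continuousOn
  obtain ⟨B, hB⟩ : ∃ B, ∀ i, ∀ t ∈ Set.Icc 0 T, |D i t| ≤ B := by
    refine ⟨1 + ∑ k, |C k|, fun i t ht => (abs_sub _ _).trans (add_le_add (hS i t) ?_)⟩
    exact ((hC i t ht).trans (le_abs_self _)).trans
      (Finset.single_le_sum (f := fun k => |C k|) (fun k _ => abs_nonneg _) (Finset.mem_univ i))
  have hJ : ∀ i, ∑ k, (jumpLaw Q i k).toReal = 1 := fun i => by
    rw [← ENNReal.toReal_sum fun k _ => (jumpLaw Q i).apply_ne_top k,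
      ← tsum_fintype (L := SummationFilter.unconditional _),
      (jumpLaw Q i).tsum_coe, ENNReal.toReal_one]
  -- The sum of all exit rates dominates each of them, so `θ` bounds the probability of a jump
  -- before `T` from any state.
  set θ := 1 - Real.exp (-((∑ k, -Q k k) * T)) with hθ
  have step : ∀ B : ℝ, (∀ i, ∀ t ∈ Set.Icc 0 T, |D i t| ≤ B) →
      ∀ i, ∀ t ∈ Set.Icc 0 T, |D i t| ≤ θ * B := by
    intro B hB i t ht
    have hT : 0 ≤ T := ht.1.trans ht.2
    have hB0 : 0 ≤ B := (abs_nonneg _).trans (hB i t ht)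
    have hqsum : -Q i i ≤ ∑ k, -Q k k :=
      Finset.single_le_sum (f := fun k => -Q k k) (fun k _ => neg_diag_nonneg hQ k) (Finset.mem_univ i)
    rcases (neg_diag_nonneg hQ i).eq_or_lt with hi | hi
    · have : D i t = 0 := by
        simp only [hD]
        rw [settledProb_of_diag_eq_zero hi.symm, exp_smul_apply_of_diag_eq_zero hQ hi.symm, sub_self]
      rw [this, abs_zero]
      refine mul_nonneg ?_ hB0
      rw [hθ, sub_nonneg, Real.exp_le_one_iff]
      have := mul_nonneg (hi.le.trans hqsum) hT
      linarith
    · set q := -Q i i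
      have hqt : 0 ≤ q * t := mul_nonneg hi.le ht.1
      have hexpint : IntervalIntegrable (fun x => Real.exp (-x) * ∑ k, (jumpLaw Q i k).toReal *
          NormedSpace.exp ((t - x / q) • Q) k j) volume 0 (q * t) := by
        refine Continuous.intervalIntegrable ?_ _ _
        refine (Real.continuous_exp.comp continuous_neg).mul (continuous_finsetSum _ fun k _ => ?_)
        exact continuous_const.mul ((hcont k).comp (by fun_prop))
      have hprobint : IntervalIntegrable (fun x => Real.exp (-x) * ∑ k, (jumpLaw Q i k).toReal *
          settledProb Q k j (t - x / q)) volume 0 (q * t) := by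
        refine IntervalIntegrable.continuousOn_mul ?_ (by fun_prop)
        suffices h : ∀ k, IntervalIntegrable (fun x => settledProb Q k j (t - x / q)) volume
            0 (q * t) by
          simpa only [Finset.sum_fn] using
            IntervalIntegrable.sum Finset.univ fun k _ => (h k).const_mul (jumpLaw Q i k).toReal
        intro k
        refine (intervalIntegrable_const (c := (1 : ℝ))).mono_fun
          ((measurable_settledProb Q k j).comp
            (measurable_const.sub (measurable_id.div_const q))).aestronglyMeasurable
          (Eventually.of_forall fun x => ?_)
        simpa using hS k _
      have heq : D i t = ∫ x in (0 : ℝ)..(q * t), Real.exp (-x) *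
          ∑ k, (jumpLaw Q i k).toReal * D k (t - x / q) := by
        simp only [hD]
        rw [settledProb_eq_add_integral hi j ht.1, exp_smul_apply_eq_add_integral hQ hi j t,
          add_sub_add_left_eq_sub, ← intervalIntegral.integral_sub hprobint hexpint]
        refine intervalIntegral.integral_congr fun x _ => ?_
        simp only [← mul_sub, ← Finset.sum_sub_distrib]
      have hexpI : ∫ x in (0 : ℝ)..(q * t), Real.exp (-x) * B = (1 - Real.exp (-(q * t))) * B := by
        simp
      calc |D i t| ≤ ∫ x in (0 : ℝ)..(q * t), Real.exp (-x) * B := by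
            rw [heq, ← Real.norm_eq_abs]
            refine intervalIntegral.norm_integral_le_of_norm_le hqt (Eventually.of_forall
              fun x hx => ?_) (Continuous.intervalIntegrable
              (u := fun x => Real.exp (-x) * B) (by fun_prop) _ _)
            rw [norm_mul, Real.norm_eq_abs, Real.abs_exp]
            gcongr
            have hx' : t - x / q ∈ Set.Icc 0 T := by
              have h1 : x / q ≤ t := by rw [div_le_iff₀ hi, mul_comm]; exact hx.2
              have h2 : 0 ≤ x / q := div_nonneg hx.1.le hi.le
              exact ⟨by linarith, by linarith [ht.2]⟩
            calc ‖∑ k, (jumpLaw Q i k).toReal * D k (t - x / q)‖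
                ≤ ∑ k, (jumpLaw Q i k).toReal * B := by
                  refine norm_sum_le_of_le _ fun k _ => ?_
                  rw [norm_mul, Real.norm_eq_abs, ENNReal.abs_toReal]
                  gcongr
                  exact hB k _ hx'
              _ = B := by rw [← Finset.sum_mul, hJ, one_mul]
        _ = (1 - Real.exp (-(q * t))) * B := hexpI
        _ ≤ θ * B := by
            rw [hθ]
            gcongr
            · exact ht.1
            · exact hi.le.trans hqsum
            · exact ht.2
  have hn : ∀ n : ℕ, ∀ i, ∀ t ∈ Set.Icc 0 T, |D i t| ≤ θ ^ n * B := by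
    intro n
    induction n with
    | zero => simpa using hB
    | succ n ih =>
      intro i t ht
      rw [pow_succ', mul_assoc]
      exact step _ ih i t ht
  intro i t ht
  have hT : 0 ≤ T := ht.1.trans ht.2
  have hθ0 : 0 ≤ θ := by
    rw [hθ, sub_nonneg, Real.exp_le_one_iff]
    have := mul_nonneg (Finset.sum_nonneg fun k (_ : k ∈ Finset.univ) => neg_diag_nonneg hQ k) hT
    linarith
  have hθ1 : θ < 1 := by rw [hθ]; linarith [Real.exp_pos (-((∑ k, -Q k k) * T))]
  have hlim : Tendsto (fun n : ℕ => θ ^ n * B) atTop (𝓝 0) := by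
    simpa using (tendsto_pow_atTop_nhds_zero_of_lt_one hθ0 hθ1).mul_const B
  have h0 : |D i t| ≤ 0 := ge_of_tendsto' hlim fun n => hn n i t ht
  exact sub_eq_zero.1 (abs_nonpos_iff.1 h0)

/-- The transition probabilities of the chain are the entries of the matrix exponential. -/
theorem noiseLaw_chain_eq {Q : Matrix (Fin d) (Fin d) ℝ} (hQ : IsRateMatrix Q) (i j : Fin d) {t : ℝ}
    (ht : 0 ≤ t) : (noiseLaw Q).real {ω | chain Q i t ω = j} = NormedSpace.exp (t • Q) i j := by
  have hle : ∀ k, NormedSpace.exp (t • Q) i k ≤ (noiseLaw Q).real {ω | chain Q i t ω = k} := fun k => by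
    rw [← settledProb_eq_exp_smul_apply hQ k i t ⟨ht, le_rfl⟩]
    exact measureReal_mono (settled_subset_chain Q i k t)
  have hm : ∀ k, MeasurableSet {ω | chain Q i t ω = k} := fun k =>
    ((measurable_chain Q i).comp measurable_prodMk_left) (measurableSet_singleton k)
  have hsum : ∑ k, (noiseLaw Q).real {ω | chain Q i t ω = k} = 1 := by
    rw [← measureReal_biUnion_finset (fun k _ l _ hkl => ?_) fun k _ => hm k]
    · convert probReal_univ (μ := noiseLaw Q)
      ext ω; simp
    · exact Set.disjoint_left.2 fun ω hk hl => hkl (hk.symm.trans hl)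
  -- Both families sum to one over the states, so the inequalities are equalities: the convention in
  -- `chain` for explosion costs nothing.
  have := (Finset.sum_eq_sum_iff_of_le fun k (_ : k ∈ Finset.univ) => hle k).1
    ((sum_exp_smul_apply hQ i t).trans hsum.symm)
  exact (this j (Finset.mem_univ j)).symm

end RateMatrix

/-! ### Values as time integrals -/

theorem integral_setIntegral_comp_process {Ω : Type*} [MeasurableSpace Ω] {d : ℕ} (P : Measure Ω)
    [IsProbabilityMeasure P] {X : ℝ → Ω → Fin d} (hX : Measurable fun p : ℝ × Ω => X p.1 p.2)
    {R : ℝ → Fin d → ℝ} (hR : ∀ k, IntegrableOn (fun s => R s k) (Set.Ioi 0)) :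
    ∫ ω, (∫ s in Set.Ioi (0 : ℝ), R s (X s ω)) ∂P =
      ∫ s in Set.Ioi (0 : ℝ), ∑ k, P.real {ω | X s ω = k} * R s k := by
  have hset : ∀ k, MeasurableSet {p : ℝ × Ω | X p.1 p.2 = k} := fun k => hX (measurableSet_singleton k)
  have heq : ∀ p : ℝ × Ω, R p.1 (X p.1 p.2) =
      ∑ k, {p : ℝ × Ω | X p.1 p.2 = k}.indicator (fun p => R p.1 k) p := fun p => by
    simp [Set.indicator_apply]
  have hint : ∀ k, Integrable ({p : ℝ × Ω | X p.1 p.2 = k}.indicator fun p => R p.1 k)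
      ((volume.restrict (Set.Ioi (0 : ℝ))).prod P) := fun k =>
    ((hR k).comp_fst P).indicator (hset k)
  have hint' : Integrable (fun p : ℝ × Ω => R p.1 (X p.1 p.2))
      ((volume.restrict (Set.Ioi (0 : ℝ))).prod P) := by
    simp_rw [heq]; exact integrable_finsetSum _ fun k _ => hint k
  -- After Fubini only the one-time marginals of `X` matter.
  rw [← integral_integral_swap hint']
  refine integral_congr_ae (Eventually.of_forall fun s => ?_)
  have hs : ∀ k, MeasurableSet {ω | X s ω = k} := fun k => measurable_prodMk_left (hset k)
  have h1 : ∀ ω, R s (X s ω) = ∑ k, {ω | X s ω = k}.indicator (fun _ => R s k) ω := fun ω => by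
    simp [Set.indicator_apply]
  simp_rw [h1]
  rw [integral_finsetSum _ fun k _ => (integrable_const _).indicator (hs k)]
  simp_rw [integral_indicator_const _ (hs _), smul_eq_mul]

namespace ControlledChain

open RateMatrix

variable {d ℓ : ℕ} {M : ControlledChain d ℓ}

theorem LipschitzCondition.continuousOn_f (h : M.LipschitzCondition) {t : ℝ} (ht : 0 ≤ t) (i : Fin d) :
    ContinuousOn (M.f t i) M.U := by
  obtain ⟨Θ, hΘ⟩ := h
  refine (LipschitzOnWith.of_dist_le_mul (K := Θ.toNNReal) fun u hu v hv => ?_).continuousOn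
  rw [Real.dist_eq, dist_eq_norm]
  calc |M.f t i u - M.f t i v| ≤ Θ * ‖u - v‖ :=
        (le_add_of_nonneg_right (norm_nonneg _)).trans (hΘ t ht i u hu v hv)
    _ ≤ _ := mul_le_mul_of_nonneg_right (Real.le_coe_toNNReal Θ) (norm_nonneg _)

theorem LipschitzCondition.continuousOn_q (h : M.LipschitzCondition) (i j : Fin d) :
    ContinuousOn (fun u => M.q u i j) M.U := by
  obtain ⟨Θ, hΘ⟩ := h
  refine (LipschitzOnWith.of_dist_le_mul (K := Θ.toNNReal) fun u hu v hv => ?_).continuousOn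
  rw [Real.dist_eq, dist_eq_norm]
  have h1 := PiLp.norm_apply_le (WithLp.toLp 2 (M.q u i - M.q v i)) j
  calc |M.q u i j - M.q v i j| ≤ Θ * ‖u - v‖ :=
        h1.trans ((le_add_of_nonneg_left (abs_nonneg _)).trans (hΘ 0 le_rfl i u hu v hv))
    _ ≤ _ := mul_le_mul_of_nonneg_right (Real.le_coe_toNNReal Θ) (norm_nonneg _)

theorem IsAdmissible.nonempty (hM : M.IsAdmissible) : M.U.Nonempty :=
  nonempty_of_measure_ne_zero hM.volume_pos.ne'

theorem integrableOn_continuousOn_mul_density (hM : M.IsAdmissible)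
    {ρ g : EuclideanSpace ℝ (Fin ℓ) → ℝ} (hρ : M.IsDensity ρ) (hg : ContinuousOn g M.U) :
    IntegrableOn (fun u => g u * ρ u) M.U :=
  hρ.1.continuousOn_mul hg hM.isCompact

theorem isRateMatrix_relaxedRate (hM : M.IsAdmissible) (hlip : M.LipschitzCondition)
    {π : Fin d → EuclideanSpace ℝ (Fin ℓ) → ℝ} (hπ : M.IsRegular π) :
    IsRateMatrix (M.relaxedRate π) := by
  have hU := hM.isCompact.measurableSet
  refine ⟨fun i j hij => setIntegral_nonneg hU fun u hu =>
    mul_nonneg ((hM.rate u hu).1 i j hij) ((hπ i).1.2.1 u hu), fun i => ?_⟩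
  simp only [relaxedRate]
  rw [← integral_finsetSum _ fun j _ =>
    integrableOn_continuousOn_mul_density hM (hπ i).1 (hlip.continuousOn_q i j), ← integral_neg]
  refine setIntegral_congr_fun hU fun u hu => ?_
  simp only [(hM.rate u hu).2 i, ← Finset.sum_mul, neg_mul]

/-- The running reward in state `k` at time `s`, including the entropy term. -/
noncomputable def runningReward (M : ControlledChain d ℓ) (lam : ℝ)
    (π : Fin d → EuclideanSpace ℝ (Fin ℓ) → ℝ) (s : ℝ) (k : Fin d) : ℝ :=
  M.relaxedReward (π k) s k + lam * M.δ s * M.entropy (π k)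

/-- On the bounded set `U` the oscillation of `f t i` is bounded uniformly in `t`. One reference
action thus controls all others, which yields domination near a given time. -/
theorem LipschitzCondition.exists_bound (hM : M.IsAdmissible) (hlip : M.LipschitzCondition) :
    ∃ u₀ ∈ M.U, ∃ C, ∀ t, 0 ≤ t → ∀ i, ∀ u ∈ M.U, |M.f t i u| ≤ |M.f t i u₀| + C := by
  obtain ⟨u₀, hu₀⟩ := hM.nonempty
  obtain ⟨Θ, hΘ⟩ := hlip
  obtain ⟨D, hD⟩ := hM.isCompact.isBounded.exists_norm_le
  refine ⟨u₀, hu₀, |Θ| * (D + D), fun t ht i u hu => ?_⟩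
  have h1 : |M.f t i u - M.f t i u₀| ≤ |Θ| * (D + D) :=
    calc |M.f t i u - M.f t i u₀| ≤ Θ * ‖u - u₀‖ :=
          (le_add_of_nonneg_right (norm_nonneg _)).trans (hΘ t ht i u hu u₀ hu₀)
      _ ≤ |Θ| * (D + D) := mul_le_mul (le_abs_self Θ)
          ((norm_sub_le _ _).trans (add_le_add (hD u hu) (hD u₀ hu₀))) (norm_nonneg _) (abs_nonneg _)
  have h2 := abs_add_le (M.f t i u - M.f t i u₀) (M.f t i u₀)
  rw [sub_add_cancel] at h2
  linarith

theorem continuousOn_relaxedReward (hM : M.IsAdmissible) (hlip : M.LipschitzCondition)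
    (hf : ∀ i, ∀ u ∈ M.U, ContinuousOn (fun t => M.f t i u) (Set.Ici 0))
    {ρ : EuclideanSpace ℝ (Fin ℓ) → ℝ} (hρ : M.IsDensity ρ) (i : Fin d) :
    ContinuousOn (fun t => M.relaxedReward ρ t i) (Set.Ici 0) := by
  intro t₀ ht₀
  obtain ⟨u₀, hu₀, C, hC⟩ := hlip.exists_bound hM
  have hU := hM.isCompact.measurableSet
  refine continuousWithinAt_of_dominated (bound := fun u => (|M.f t₀ i u₀| + 1 + C) * |ρ u|)
    ?_ ?_ (hρ.1.abs.const_mul _) ?_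
  · filter_upwards [self_mem_nhdsWithin] with t ht
    exact (integrableOn_continuousOn_mul_density hM hρ
      (hlip.continuousOn_f ht i)).aestronglyMeasurable
  · have h1 := ((hf i u₀ hu₀ t₀ ht₀).abs).eventually_lt_const (lt_add_one _)
    filter_upwards [self_mem_nhdsWithin, h1] with t ht h1
    filter_upwards [ae_restrict_mem hU] with u hu
    rw [norm_mul, Real.norm_eq_abs, Real.norm_eq_abs]
    gcongr
    linarith [hC t ht i u hu]
  · filter_upwards [ae_restrict_mem hU] with u hu
    exact (hf i u hu t₀ ht₀).mul continuousWithinAt_const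

theorem continuousOn_runningReward (hM : M.IsAdmissible) (hlip : M.LipschitzCondition)
    (hf : ∀ i, ∀ u ∈ M.U, ContinuousOn (fun t => M.f t i u) (Set.Ici 0))
    (hδ : ContinuousOn M.δ (Set.Ici 0)) (lam : ℝ)
    {π : Fin d → EuclideanSpace ℝ (Fin ℓ) → ℝ} (hπ : M.IsRegular π) (k : Fin d) :
    ContinuousOn (fun s => M.runningReward lam π s k) (Set.Ici 0) :=
  (continuousOn_relaxedReward hM hlip hf (hπ k).1 k).add
    ((continuousOn_const.mul hδ).mul continuousOn_const)

theorem integrableOn_discount (hM : M.IsAdmissible) (hint : M.IntegrabilityCondition)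
    (hδ : ContinuousOn M.δ (Set.Ici 0)) : IntegrableOn M.δ (Set.Ioi 0) := by
  refine ⟨(hδ.mono Set.Ioi_subset_Ici_self).aestronglyMeasurable measurableSet_Ioi, ?_⟩
  rw [hasFiniteIntegral_iff_norm]
  refine lt_of_le_of_lt (setLIntegral_mono' measurableSet_Ioi fun s hs => ?_) hint
  rw [Real.norm_eq_abs, abs_of_nonneg (hM.discount_nonneg s (Set.mem_Ioi.1 hs).le)]
  exact le_add_self

/-- The supremum over uncountably many actions need not be measurable in time. The supremum over a
dense sequence is, and continuity in the action extends its bound to all of `U`. -/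
theorem exists_integrableOn_bound (hM : M.IsAdmissible) (hint : M.IntegrabilityCondition)
    (hlip : M.LipschitzCondition)
    (hf : ∀ i, ∀ u ∈ M.U, ContinuousOn (fun t => M.f t i u) (Set.Ici 0)) :
    ∃ F : ℝ → ℝ, IntegrableOn F (Set.Ioi 0) ∧ ∀ᵐ s ∂volume.restrict (Set.Ioi (0 : ℝ)),
      0 ≤ F s ∧ ∀ i, ∀ u ∈ M.U, |M.f s i u| ≤ F s := by
  have : Nonempty M.U := hM.nonempty.to_subtype
  let v : ℕ → M.U := TopologicalSpace.denseSeq M.U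
  let G : ℝ → ℝ≥0∞ := fun s => ⨆ i, ⨆ n, ENNReal.ofReal |M.f s i (v n)|
  have hGm : AEMeasurable G (volume.restrict (Set.Ioi (0 : ℝ))) := by
    refine AEMeasurable.iSup fun i => AEMeasurable.iSup fun n => ?_
    exact (((hf i (v n) (v n).2).mono Set.Ioi_subset_Ici_self).aemeasurable
      measurableSet_Ioi).abs.ennreal_ofReal
  have hGfin : ∫⁻ s in Set.Ioi (0 : ℝ), G s ≠ ∞ := by
    refine (lt_of_le_of_lt (lintegral_mono fun s => ?_) hint).ne
    refine le_add_right (iSup_mono fun i => iSup_le fun n => ?_)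
    exact le_iSup₂_of_le (v n : EuclideanSpace ℝ (Fin ℓ)) (v n).2 le_rfl
  refine ⟨fun s => (G s).toReal, integrable_toReal_of_lintegral_ne_top hGm hGfin, ?_⟩
  filter_upwards [ae_lt_top' hGm hGfin, ae_restrict_mem measurableSet_Ioi] with s hs hs0
  refine ⟨ENNReal.toReal_nonneg, fun i u hu => ?_⟩
  rw [← ENNReal.ofReal_le_iff_le_toReal hs.ne]
  have hc : Continuous fun u : M.U => ENNReal.ofReal |M.f s i u| :=
    ENNReal.continuous_ofReal.comp
      (continuousOn_iff_continuous_domRestrict.1 (hlip.continuousOn_f (Set.mem_Ioi.1 hs0).le i)).abs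
  have hcl : IsClosed {u : M.U | ENNReal.ofReal |M.f s i u| ≤ G s} :=
    isClosed_le hc continuous_const
  exact (TopologicalSpace.denseRange_denseSeq M.U).induction_on
    (p := fun u : M.U => ENNReal.ofReal |M.f s i u| ≤ G s) (⟨u, hu⟩ : M.U) hcl fun n =>
    le_iSup₂_of_le (f := fun i n => ENNReal.ofReal |M.f s i (v n)|) i n le_rfl

theorem abs_relaxedReward_le (hM : M.IsAdmissible) {ρ : EuclideanSpace ℝ (Fin ℓ) → ℝ}
    (hρ : M.IsDensity ρ) {s C : ℝ} {i : Fin d} (hC : ∀ u ∈ M.U, |M.f s i u| ≤ C) :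
    |M.relaxedReward ρ s i| ≤ C := by
  have hU := hM.isCompact.measurableSet
  calc |M.relaxedReward ρ s i| ≤ ∫ u in M.U, C * ρ u := by
        rw [relaxedReward, ← Real.norm_eq_abs]
        refine norm_integral_le_of_norm_le (hρ.1.const_mul C) ?_
        filter_upwards [ae_restrict_mem hU] with u hu
        rw [norm_mul, Real.norm_eq_abs, Real.norm_eq_abs, abs_of_nonneg (hρ.2.1 u hu)]
        exact mul_le_mul_of_nonneg_right (hC u hu) (hρ.2.1 u hu)
    _ = C := by rw [integral_const_mul, hρ.2.2, mul_one]

theorem abs_runningReward_le (hM : M.IsAdmissible) {lam : ℝ} (hlam : 0 < lam)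
    {π : Fin d → EuclideanSpace ℝ (Fin ℓ) → ℝ} (hπ : M.IsRegular π) {s C : ℝ} (hs : 0 ≤ s) {k : Fin d}
    (hC : ∀ u ∈ M.U, |M.f s k u| ≤ C) :
    |M.runningReward lam π s k| ≤ C + lam * M.δ s * |M.entropy (π k)| := by
  refine (abs_add_le _ _).trans (add_le_add (abs_relaxedReward_le hM (hπ k).1 hC) ?_)
  rw [abs_mul, abs_of_nonneg (mul_nonneg hlam.le (hM.discount_nonneg s hs))]

theorem integrableOn_runningReward (hM : M.IsAdmissible) (hint : M.IntegrabilityCondition)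
    (hlip : M.LipschitzCondition)
    (hf : ∀ i, ∀ u ∈ M.U, ContinuousOn (fun t => M.f t i u) (Set.Ici 0))
    (hδ : ContinuousOn M.δ (Set.Ici 0)) {lam : ℝ} (hlam : 0 < lam)
    {π : Fin d → EuclideanSpace ℝ (Fin ℓ) → ℝ} (hπ : M.IsRegular π) (k : Fin d) :
    IntegrableOn (fun s => M.runningReward lam π s k) (Set.Ioi 0) := by
  obtain ⟨F, hF, hFb⟩ := exists_integrableOn_bound hM hint hlip hf
  refine Integrable.mono' (hF.add (((integrableOn_discount hM hint hδ).const_mul lam).mul_const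
    |M.entropy (π k)|)) (((continuousOn_runningReward hM hlip hf hδ lam hπ k).mono
      Set.Ioi_subset_Ici_self).aestronglyMeasurable measurableSet_Ioi) ?_
  filter_upwards [hFb, ae_restrict_mem measurableSet_Ioi] with s hs hs0
  exact abs_runningReward_le hM hlam hπ (Set.mem_Ioi.1 hs0).le (hs.2 k)

theorem value_eq_integral (hM : M.IsAdmissible) (hint : M.IntegrabilityCondition)
    (hlip : M.LipschitzCondition)
    (hf : ∀ i, ∀ u ∈ M.U, ContinuousOn (fun t => M.f t i u) (Set.Ici 0))
    (hδ : ContinuousOn M.δ (Set.Ici 0)) {lam : ℝ} (hlam : 0 < lam)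
    {π : Fin d → EuclideanSpace ℝ (Fin ℓ) → ℝ} (hπ : M.IsRegular π) (i : Fin d) :
    M.value lam π i = ∫ s in Set.Ioi (0 : ℝ),
      ∑ k, NormedSpace.exp (s • M.relaxedRate π) i k * M.runningReward lam π s k := by
  have hQ := isRateMatrix_relaxedRate hM hlip hπ
  have h := integral_setIntegral_comp_process (noiseLaw (M.relaxedRate π))
    (measurable_chain (M.relaxedRate π) i)
    (integrableOn_runningReward hM hint hlip hf hδ hlam hπ)
  refine h.trans (setIntegral_congr_fun measurableSet_Ioi fun s hs => ?_)
  exact Finset.sum_congr rfl fun k _ => by rw [noiseLaw_chain_eq hQ i k (Set.mem_Ioi.1 hs).le]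

theorem measurable_concatChain (π' π : Fin d → EuclideanSpace ℝ (Fin ℓ) → ℝ) (ε : ℝ) (i : Fin d) :
    Measurable fun p : ℝ × (Noise d × Noise d) => M.concatChain π' π ε i p.1 p.2 := by
  unfold concatChain
  refine Measurable.ite (measurableSet_lt measurable_fst measurable_const) ?_ ?_
  · exact (measurable_chain _ i).comp (measurable_fst.prodMk (measurable_fst.comp measurable_snd))
  · have h1 : Measurable fun p : Fin d × ℝ × Noise d => chain (M.relaxedRate π) p.1 p.2.1 p.2.2 :=
      measurable_from_prod_countable_right fun k => measurable_chain _ k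
    have h2 : Measurable fun ω : Noise d => chain (M.relaxedRate π') i ε ω :=
      (measurable_chain _ i).comp measurable_prodMk_left
    exact h1.comp ((h2.comp (measurable_fst.comp measurable_snd)).prodMk
      ((measurable_fst.sub_const ε).prodMk (measurable_snd.comp measurable_snd)))

theorem prod_noiseLaw_concatChain_eq (hM : M.IsAdmissible) (hlip : M.LipschitzCondition)
    {π' π : Fin d → EuclideanSpace ℝ (Fin ℓ) → ℝ} (hπ' : M.IsRegular π') (hπ : M.IsRegular π)
    {ε : ℝ} (hε : 0 ≤ ε) (i j : Fin d) {s : ℝ} (hs : 0 ≤ s) :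
    ((noiseLaw (M.relaxedRate π')).prod (noiseLaw (M.relaxedRate π))).real
      {ω | M.concatChain π' π ε i s ω = j} =
    if s < ε then NormedSpace.exp (s • M.relaxedRate π') i j else
      (NormedSpace.exp (ε • M.relaxedRate π') * NormedSpace.exp ((s - ε) • M.relaxedRate π)) i j := by
  have hQ' := isRateMatrix_relaxedRate hM hlip hπ'
  have hQ := isRateMatrix_relaxedRate hM hlip hπ
  split_ifs with h
  · have : {ω | M.concatChain π' π ε i s ω = j} =
        {ω | chain (M.relaxedRate π') i s ω = j} ×ˢ Set.univ := by
      ext ω; simp [concatChain, h]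
    rw [this, measureReal_prod_prod, noiseLaw_chain_eq hQ' i j hs, probReal_univ, mul_one]
  · have hse : 0 ≤ s - ε := by linarith
    have : {ω | M.concatChain π' π ε i s ω = j} = ⋃ k ∈ Finset.univ,
        {ω | chain (M.relaxedRate π') i ε ω = k} ×ˢ {ω | chain (M.relaxedRate π) k (s - ε) ω = j} := by
      ext ω; simp [concatChain, h]
    have hm : ∀ (Q : Matrix (Fin d) (Fin d) ℝ) (k l : Fin d) (t : ℝ),
        MeasurableSet {ω | chain Q k t ω = l} := fun Q k l t =>
      ((measurable_chain Q k).comp measurable_prodMk_left) (measurableSet_singleton l)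
    rw [this, measureReal_biUnion_finset, Matrix.mul_apply]
    · refine Finset.sum_congr rfl fun k _ => ?_
      rw [measureReal_prod_prod, noiseLaw_chain_eq hQ' i k hε, noiseLaw_chain_eq hQ k j hse]
    · intro k _ l _ hkl
      exact Set.disjoint_left.2 fun ω hk hl => hkl (hk.1.symm.trans hl.1)
    · exact fun k _ => (hm _ _ _ _).prod (hm _ _ _ _)

end ControlledChain

/-! ### The one-sided derivative of a short deviation -/

namespace RateMatrix

variable {d : ℕ}

theorem continuous_exp_smul_apply (Q : Matrix (Fin d) (Fin d) ℝ) (i j : Fin d) :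
    Continuous fun s : ℝ => NormedSpace.exp (s • Q) i j :=
  continuous_iff_continuousAt.2 fun s => (hasDerivAt_exp_smul_apply Q i j s).continuousAt

theorem abs_exp_smul_apply_le_one {Q : Matrix (Fin d) (Fin d) ℝ} (hQ : IsRateMatrix Q) (i j : Fin d)
    {t : ℝ} (ht : 0 ≤ t) : |NormedSpace.exp (t • Q) i j| ≤ 1 := by
  rw [← noiseLaw_chain_eq hQ i j ht, abs_of_nonneg measureReal_nonneg]
  exact measureReal_le_one

theorem integrableOn_exp_smul_mul {Q : Matrix (Fin d) (Fin d) ℝ} (hQ : IsRateMatrix Q) (i k : Fin d)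
    {r : ℝ → ℝ} (hr : IntegrableOn r (Set.Ioi 0)) :
    IntegrableOn (fun s => NormedSpace.exp (s • Q) i k * r s) (Set.Ioi 0) := by
  refine Integrable.bdd_mul (c := 1) hr
    (continuous_exp_smul_apply Q i k).aestronglyMeasurable ?_
  filter_upwards [ae_restrict_mem measurableSet_Ioi] with s hs
  exact abs_exp_smul_apply_le_one hQ i k (Set.mem_Ioi.1 hs).le

/-- The derivative at zero of the quotient of two matrix exponentials. -/
theorem tendsto_exp_mul_exp_neg_sub_one_div (Q' Q : Matrix (Fin d) (Fin d) ℝ) (i l : Fin d) :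
    Tendsto (fun ε : ℝ => ((NormedSpace.exp (ε • Q') * NormedSpace.exp ((-ε) • Q)) i l -
      (1 : Matrix (Fin d) (Fin d) ℝ) i l) / ε) (𝓝[>] 0) (𝓝 (Q' i l - Q i l)) := by
  have h : HasDerivAt (fun ε : ℝ => (NormedSpace.exp (ε • Q') * NormedSpace.exp ((-ε) • Q)) i l)
      (Q' i l - Q i l) 0 := by
    simp_rw [Matrix.mul_apply]
    have h2 : ∀ k, HasDerivAt (fun ε : ℝ => NormedSpace.exp ((-ε) • Q) k l) (-Q k l) 0 := by
      intro k
      have h3 := hasDerivAt_exp_smul_apply Q k l (-0)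
      exact (h3.comp (0 : ℝ) (hasDerivAt_neg 0)).congr_deriv (by simp)
    refine (HasDerivAt.fun_sum fun k _ =>
      (hasDerivAt_exp_smul_apply Q' i k 0).mul (h2 k)).congr_deriv ?_
    simp [Matrix.one_apply, Finset.sum_add_distrib, sub_eq_add_neg]
  have h' := (hasDerivAt_iff_tendsto_slope.1 h).mono_left
    (nhdsWithin_mono 0 fun ε (hε : 0 < ε) => hε.ne')
  refine h'.congr fun ε => ?_
  simp [slope_def_field]

end RateMatrix

theorem tendsto_setIntegral_Ioc_div {h : ℝ → ℝ} (hint : IntegrableOn h (Set.Ioi 0))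
    (hc : ContinuousOn h (Set.Ici 0)) :
    Tendsto (fun ε : ℝ => (∫ s in Set.Ioc 0 ε, h s) / ε) (𝓝[>] 0) (𝓝 (h 0)) := by
  have hd : HasDerivWithinAt (fun ε => ∫ s in (0 : ℝ)..ε, h s) (h 0) (Set.Ici 0) 0 := by
    refine intervalIntegral.integral_hasDerivWithinAt_right (t := Set.Ioi 0)
      (by simp) ?_ ((hc 0 Set.self_mem_Ici).mono Set.Ioi_subset_Ici_self)
    exact ⟨Set.Ioi 0, self_mem_nhdsWithin, hint.aestronglyMeasurable⟩
  have h1 := hasDerivWithinAt_iff_tendsto_slope.1 hd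
  rw [Set.Ici_sdiff_left] at h1
  refine h1.congr' ?_
  filter_upwards [self_mem_nhdsWithin] with ε hε
  rw [slope_def_field, intervalIntegral.integral_same, sub_zero, sub_zero,
    intervalIntegral.integral_of_le (Set.mem_Ioi.1 hε).le]

theorem tendsto_setIntegral_Ioi {h : ℝ → ℝ} (hint : IntegrableOn h (Set.Ioi 0))
    (hc : ContinuousOn h (Set.Ici 0)) :
    Tendsto (fun ε : ℝ => ∫ s in Set.Ioi ε, h s) (𝓝[>] 0) (𝓝 (∫ s in Set.Ioi 0, h s)) := by
  have h0 : Tendsto (fun ε : ℝ => ε) (𝓝[>] 0) (𝓝 0) := tendsto_nhdsWithin_of_tendsto_nhds tendsto_id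
  have h1 := tendsto_const_nhds (x := ∫ s in Set.Ioi 0, h s).sub
    ((tendsto_setIntegral_Ioc_div hint hc).mul h0)
  rw [mul_zero, sub_zero] at h1
  refine h1.congr' ?_
  filter_upwards [self_mem_nhdsWithin] with ε hε
  rw [Set.mem_Ioi] at hε
  rw [div_mul_cancel₀ _ hε.ne', ← Set.Ioc_union_Ioi_eq_Ioi hε.le,
    setIntegral_union Set.Ioc_disjoint_Ioi_same measurableSet_Ioi
    (hint.mono_set Set.Ioc_subset_Ioi_self) (hint.mono_set (Set.Ioi_subset_Ioi hε.le)),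
    add_sub_cancel_left]

namespace ControlledChain

open RateMatrix

variable {d ℓ : ℕ} {M : ControlledChain d ℓ}

/-- After time `ε` the transition matrix is `exp (ε Q') exp (-ε Q) exp (s Q)`, so the integrand is
that of the value of `π`, and `ε` enters only through a prefactor and the lower limit. The factor
`exp (-ε Q)` is purely algebraic. -/
theorem concatValue_eq_integral (hM : M.IsAdmissible) (hint : M.IntegrabilityCondition)
    (hlip : M.LipschitzCondition)
    (hf : ∀ i, ∀ u ∈ M.U, ContinuousOn (fun t => M.f t i u) (Set.Ici 0))
    (hδ : ContinuousOn M.δ (Set.Ici 0)) {lam : ℝ} (hlam : 0 < lam)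
    {π' π : Fin d → EuclideanSpace ℝ (Fin ℓ) → ℝ} (hπ' : M.IsRegular π') (hπ : M.IsRegular π)
    {ε : ℝ} (hε : 0 < ε) (i : Fin d) :
    M.concatValue lam π' π ε i =
      (∫ s in Set.Ioc 0 ε, ∑ k, NormedSpace.exp (s • M.relaxedRate π') i k *
        M.runningReward lam π' s k) +
      ∑ l, (NormedSpace.exp (ε • M.relaxedRate π') * NormedSpace.exp ((-ε) • M.relaxedRate π)) i l *
        ∫ s in Set.Ioi ε, ∑ k, NormedSpace.exp (s • M.relaxedRate π) l k *
          M.runningReward lam π s k := by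
  have hQ := isRateMatrix_relaxedRate hM hlip hπ
  set Q := M.relaxedRate π
  set Q' := M.relaxedRate π'
  let R : ℝ → Fin d → ℝ := fun s k =>
    if s < ε then M.runningReward lam π' s k else M.runningReward lam π s k
  have hr' := integrableOn_runningReward hM hint hlip hf hδ hlam hπ'
  have hr := integrableOn_runningReward hM hint hlip hf hδ hlam hπ
  have hR : ∀ k, IntegrableOn (fun s => R s k) (Set.Ioi 0) := fun k =>
    Integrable.piecewise (s := Set.Iio ε) measurableSet_Iio (hr' k).integrableOn (hr k).integrableOn
  have h := integral_setIntegral_comp_process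
    ((noiseLaw (M.relaxedRate π')).prod (noiseLaw (M.relaxedRate π)))
    (M.measurable_concatChain π' π ε i) hR
  have hval : M.concatValue lam π' π ε i = ∫ ω, (∫ s in Set.Ioi (0 : ℝ),
      R s (M.concatChain π' π ε i s ω)) ∂(noiseLaw Q').prod (noiseLaw Q) := by
    unfold concatValue expectedReward
    congr 1
    ext ω
    congr 1
    ext s
    simp only [R, runningReward]
    split_ifs <;> rfl
  have hintegrand : IntegrableOn (fun s => ∑ k, ((noiseLaw (M.relaxedRate π')).prod
      (noiseLaw (M.relaxedRate π))).real {ω | M.concatChain π' π ε i s ω = k} * R s k)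
      (Set.Ioi 0) := by
    refine integrable_finsetSum _ fun k _ => Integrable.bdd_mul (c := 1) (hR k) ?_ ?_
    · have := measurable_measure_prodMk_left (ν := (noiseLaw (M.relaxedRate π')).prod
        (noiseLaw (M.relaxedRate π))) (M.measurable_concatChain π' π ε i (measurableSet_singleton k))
      exact this.ennreal_toReal.aestronglyMeasurable
    · refine Eventually.of_forall fun s => ?_
      rw [Real.norm_eq_abs, abs_of_nonneg measureReal_nonneg]
      exact measureReal_le_one
  rw [hval.trans h, ← Set.Ioc_union_Ioi_eq_Ioi hε.le,
    setIntegral_union Set.Ioc_disjoint_Ioi_same measurableSet_Ioi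
    (hintegrand.mono_set Set.Ioc_subset_Ioi_self) (hintegrand.mono_set (Set.Ioi_subset_Ioi hε.le))]
  congr 1
  -- At `s = ε` the control in force is already `π`, so the endpoint is dropped as a null set.
  · rw [integral_Ioc_eq_integral_Ioo, integral_Ioc_eq_integral_Ioo]
    refine setIntegral_congr_fun measurableSet_Ioo fun s hs => ?_
    refine Finset.sum_congr rfl fun k _ => ?_
    rw [prod_noiseLaw_concatChain_eq hM hlip hπ' hπ hε.le i k hs.1.le, if_pos hs.2]
    simp only [R, if_pos hs.2]
    rfl
  · have hsum : ∀ l, IntegrableOn (fun s => ∑ k, NormedSpace.exp (s • Q) l k *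
        M.runningReward lam π s k) (Set.Ioi ε) := fun l =>
      integrable_finsetSum _ fun k _ => (integrableOn_exp_smul_mul hQ l k (hr k)).mono_set
        (Set.Ioi_subset_Ioi hε.le)
    simp_rw [← integral_const_mul]
    rw [← integral_finsetSum _ fun l _ => (hsum l).const_mul _]
    refine setIntegral_congr_fun measurableSet_Ioi fun s hs => ?_
    have hs' : ¬ s < ε := (Set.mem_Ioi.1 hs).not_gt
    have hexp : NormedSpace.exp (ε • Q') * NormedSpace.exp ((s - ε) • Q) =
        NormedSpace.exp (ε • Q') * NormedSpace.exp ((-ε) • Q) * NormedSpace.exp (s • Q) := by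
      rw [mul_assoc, ← exp_add_smul, neg_add_eq_sub]
    simp_rw [prod_noiseLaw_concatChain_eq hM hlip hπ' hπ hε.le i _ (hε.le.trans (Set.mem_Ioi.1 hs).le),
      if_neg hs', R, if_neg hs', Finset.mul_sum]
    rw [Finset.sum_comm]
    refine Finset.sum_congr rfl fun k _ => ?_
    rw [show NormedSpace.exp (ε • M.relaxedRate π') * NormedSpace.exp ((s - ε) • M.relaxedRate π) = _
      from hexp, Matrix.mul_apply, Finset.sum_mul]
    exact Finset.sum_congr rfl fun l _ => mul_assoc _ _ _

/-- The one-sided derivative in `ε` of the value of deviating to `π'` on `[0, ε)`. -/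
theorem tendsto_concatValue_sub_value_div (hM : M.IsAdmissible) (hint : M.IntegrabilityCondition)
    (hlip : M.LipschitzCondition)
    (hf : ∀ i, ∀ u ∈ M.U, ContinuousOn (fun t => M.f t i u) (Set.Ici 0))
    (hδ : ContinuousOn M.δ (Set.Ici 0)) {lam : ℝ} (hlam : 0 < lam)
    {π' π : Fin d → EuclideanSpace ℝ (Fin ℓ) → ℝ} (hπ' : M.IsRegular π') (hπ : M.IsRegular π)
    (i : Fin d) :
    Tendsto (fun ε => (M.concatValue lam π' π ε i - M.value lam π i) / ε) (𝓝[>] 0)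
      (𝓝 (M.runningReward lam π' 0 i - M.runningReward lam π 0 i +
        ∑ l, (M.relaxedRate π' i l - M.relaxedRate π i l) * M.value lam π l)) := by
  have hQ := isRateMatrix_relaxedRate hM hlip hπ
  have hQ' := isRateMatrix_relaxedRate hM hlip hπ'
  set Q := M.relaxedRate π
  set Q' := M.relaxedRate π'
  have hr' := integrableOn_runningReward hM hint hlip hf hδ hlam hπ'
  have hr := integrableOn_runningReward hM hint hlip hf hδ hlam hπ
  have hrc' := continuousOn_runningReward hM hlip hf hδ lam hπ'
  have hrc := continuousOn_runningReward hM hlip hf hδ lam hπ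
  have hI : ∀ l, IntegrableOn (fun s => ∑ k, NormedSpace.exp (s • Q) l k *
      M.runningReward lam π s k) (Set.Ioi 0) := fun l =>
    integrable_finsetSum _ fun k _ => integrableOn_exp_smul_mul hQ l k (hr k)
  have hC : ∀ l, ContinuousOn (fun s => ∑ k, NormedSpace.exp (s • Q) l k *
      M.runningReward lam π s k) (Set.Ici 0) := fun l =>
    continuousOn_finsetSum _ fun k _ => (continuous_exp_smul_apply Q l k).continuousOn.mul (hrc k)
  have hI' : IntegrableOn (fun s => ∑ k, NormedSpace.exp (s • Q') i k *
      M.runningReward lam π' s k) (Set.Ioi 0) :=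
    integrable_finsetSum _ fun k _ => integrableOn_exp_smul_mul hQ' i k (hr' k)
  have hC' : ContinuousOn (fun s => ∑ k, NormedSpace.exp (s • Q') i k *
      M.runningReward lam π' s k) (Set.Ici 0) :=
    continuousOn_finsetSum _ fun k _ => (continuous_exp_smul_apply Q' i k).continuousOn.mul (hrc' k)
  have hlim := ((tendsto_setIntegral_Ioc_div hI' hC').sub (tendsto_setIntegral_Ioc_div (hI i) (hC i))).add
    (tendsto_finsetSum Finset.univ fun l _ => (tendsto_exp_mul_exp_neg_sub_one_div Q' Q i l).mul
      (tendsto_setIntegral_Ioi (hI l) (hC l)))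
  have hval := fun l => value_eq_integral hM hint hlip hf hδ hlam hπ l
  refine Tendsto.congr' ?_ (hlim.trans_eq ?_)
  · filter_upwards [self_mem_nhdsWithin] with ε hε
    rw [Set.mem_Ioi] at hε
    rw [concatValue_eq_integral hM hint hlip hf hδ hlam hπ' hπ hε i, hval i,
      ← Set.Ioc_union_Ioi_eq_Ioi hε.le,
      setIntegral_union Set.Ioc_disjoint_Ioi_same measurableSet_Ioi
        ((hI i).mono_set Set.Ioc_subset_Ioi_self) ((hI i).mono_set (Set.Ioi_subset_Ioi hε.le))]
    -- The identity matrix subtracted from the prefactor accounts for the tail of the value of `π`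
    -- beyond `ε`.
    simp_rw [div_mul_eq_mul_div, ← Finset.sum_div, sub_mul, Finset.sum_sub_distrib,
      Matrix.one_apply, ite_mul, one_mul, zero_mul, Finset.sum_ite_eq, Finset.mem_univ, if_true]
    ring
  · simp_rw [hval]
    simp [Matrix.one_apply, Q, Q']

end ControlledChain

/-! ### Volume near a point, and integrals with a parameter -/

theorem UniformConeCondition.exists_le_volume {ℓ : ℕ} {U : Set (EuclideanSpace ℝ (Fin ℓ))}
    (h : UniformConeCondition U) (hU : volume U ≠ ∞) :
    ∃ θ > 0, ∃ c > 0, ∀ u ∈ U, ∀ r, 0 < r → r ≤ θ →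
      c * r ^ ℓ ≤ volume.real (U ∩ Metric.ball u r) := by
  obtain ⟨θ, hθ, ι, hι0, hι, hcone⟩ := h
  set a := Real.cos ι
  have ha0 : 0 ≤ a := Real.cos_nonneg_of_mem_Icc ⟨by linarith [Real.pi_pos], hι⟩
  have ha1 : a < 1 := by
    have := Real.cos_lt_cos_of_nonneg_of_le_pi le_rfl (by linarith [Real.pi_pos]) hι0
    rwa [Real.cos_zero] at this
  -- The choice gives `a (1 + κ) = 1 - κ`. Points of the ball of radius `κ r / 2` about `u + (r / 2)
  -- e` are at distance at most `(r / 2) (1 + κ) ≤ r` from `u`, with component at least `(r / 2) (1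
  -- - κ)` along `e`, so they lie in the cone.
  set κ := (1 - a) / (1 + a) with hκ
  have hκ0 : 0 < κ := div_pos (by linarith) (by linarith)
  have hκ1 : κ ≤ 1 := (div_le_one (by linarith)).2 (by linarith)
  have hκa : a * (1 + κ) = 1 - κ := by rw [hκ]; field_simp; ring
  set V := (volume : Measure (EuclideanSpace ℝ (Fin ℓ))).real (Metric.ball 0 1)
  have hV : 0 < V := ENNReal.toReal_pos (Metric.measure_ball_pos _ _ one_pos).ne'
    measure_ball_lt_top.ne
  refine ⟨θ, hθ, (κ / 2) ^ ℓ * V, by positivity, fun u hu r hr hrθ => ?_⟩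
  obtain ⟨e, he, hsub⟩ := hcone u hu
  have hball : Metric.ball (u + (r / 2) • e) (κ / 2 * r) ⊆ U ∩ Metric.ball u r := by
    intro v hv
    obtain ⟨w, rfl⟩ : ∃ w, v = u + (r / 2) • e + w := ⟨v - (u + (r / 2) • e), by abel⟩
    have hw : ‖w‖ < κ / 2 * r := by simpa [dist_eq_norm] using hv
    have hvu : u + (r / 2) • e + w - u = (r / 2) • e + w := by abel
    have hnorm : ‖u + (r / 2) • e + w - u‖ < r / 2 * (1 + κ) := by
      rw [hvu]
      refine (norm_add_le _ _).trans_lt ?_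
      rw [norm_smul, he, Real.norm_eq_abs, abs_of_pos (half_pos hr)]
      linarith
    have hin : u + (r / 2) • e + w ∈ Metric.ball u r := by
      rw [Metric.mem_ball, dist_eq_norm]
      nlinarith
    refine ⟨hsub ⟨?_, Metric.ball_subset_ball hrθ hin⟩, hin⟩
    have h1 : -(κ / 2 * r) ≤ inner ℝ w e := by
      have := (abs_le.1 (abs_real_inner_le_norm w e)).1
      rw [he, mul_one] at this
      linarith
    calc a * ‖u + (r / 2) • e + w - u‖ ≤ a * (r / 2 * (1 + κ)) :=
          mul_le_mul_of_nonneg_left hnorm.le ha0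
      _ = r / 2 * (a * (1 + κ)) := by ring
      _ = r / 2 - κ / 2 * r := by rw [hκa]; ring
      _ ≤ inner ℝ (u + (r / 2) • e + w - u) e := by
          rw [hvu, inner_add_left, real_inner_smul_left, real_inner_self_eq_norm_sq, he]
          linarith
  calc (κ / 2) ^ ℓ * V * r ^ ℓ = volume.real (Metric.ball (u + (r / 2) • e) (κ / 2 * r)) := by
        rw [measureReal_def, Measure.addHaar_ball_of_pos _ _ (by positivity), ENNReal.toReal_mul,
          ENNReal.toReal_ofReal (by positivity), finrank_euclideanSpace_fin, mul_pow]
        simp only [V, measureReal_def]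
        ring
    _ ≤ _ := measureReal_mono hball (measure_ne_top_of_subset Set.inter_subset_left hU)

theorem continuous_setIntegral_of_continuousOn {X E : Type*} [TopologicalSpace X]
    [FirstCountableTopology X] [LocallyCompactSpace X] [TopologicalSpace E] [MeasurableSpace E]
    [BorelSpace E] [T2Space E] {μ : Measure E} [IsFiniteMeasureOnCompacts μ] {U : Set E} (hU : IsCompact U)
    {h : X → E → ℝ} (hh : ContinuousOn (fun p : X × E => h p.1 p.2) (Set.univ ×ˢ U)) :
    Continuous fun x => ∫ u in U, h x u ∂μ := by
  have : CompactSpace U := isCompact_iff_compactSpace.1 hU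
  have hfin : IsFiniteMeasure (μ.comap ((↑) : U → E)) := ⟨by
    rw [(MeasurableEmbedding.subtype_coe hU.measurableSet).comap_apply, Set.image_univ,
      Subtype.range_coe]
    exact hU.measure_lt_top⟩
  have h1 : Continuous fun p : X × U => h p.1 p.2 :=
    hh.comp_continuous (continuous_fst.prodMk (continuous_subtype_val.comp continuous_snd))
      fun p => ⟨trivial, p.2.2⟩
  have h2 := continuous_parametric_integral_of_continuous (μ := μ.comap ((↑) : U → E))
    (f := fun x (u : U) => h x u) h1 isCompact_univ
  simpa only [Measure.restrict_univ, integral_subtype_comap hU.measurableSet] using h2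

/-! ### Gibbs densities, and continuity and growth of the operator -/

namespace ControlledChain

open RateMatrix

variable {d ℓ : ℕ} {M : ControlledChain d ℓ}

/-- Gibbs' variational inequality. -/
theorem integral_mul_add_entropy_le (hM : M.IsAdmissible) {ρ : EuclideanSpace ℝ (Fin ℓ) → ℝ}
    (hρ : M.IsDensity ρ) (hρi : IntegrableOn (fun u => Real.log (ρ u) * ρ u) M.U)
    {φ : EuclideanSpace ℝ (Fin ℓ) → ℝ} (hφ : ContinuousOn φ M.U) :
    (∫ u in M.U, φ u * ρ u) + M.entropy ρ ≤ Real.log (∫ u in M.U, Real.exp (φ u)) := by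
  have hU := hM.isCompact.measurableSet
  have hexp : IntegrableOn (fun u => Real.exp (φ u)) M.U :=
    (Real.continuous_exp.comp_continuousOn hφ).integrableOn_compact hM.isCompact
  set Z := ∫ u in M.U, Real.exp (φ u) with hZdef
  have hZ : 0 < Z := by
    have : NeZero (volume.restrict M.U) := ⟨by
      simpa [Measure.restrict_eq_zero] using hM.volume_pos.ne'⟩
    exact integral_exp_pos hexp
  have hφρ := integrableOn_continuousOn_mul_density hM hρ hφ
  have hle : ∫ u in M.U, (φ u * ρ u - Real.log Z * ρ u - Real.log (ρ u) * ρ u) ≤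
      ∫ u in M.U, (Real.exp (φ u) / Z - ρ u) := by
    refine setIntegral_mono_on ((hφρ.sub (hρ.1.const_mul _)).sub hρi) ((hexp.div_const Z).sub hρ.1) hU
      fun u hu => ?_
    -- Where `ρ` vanishes the left side is zero. Elsewhere `log x ≤ x - 1` is used at `x = exp φ /
    -- (Z ρ)` and multiplied by `ρ`.
    rcases (hρ.2.1 u hu).eq_or_lt with h0 | h0
    · simp only [← h0, mul_zero, sub_zero]; positivity
    · have h1 := Real.log_le_sub_one_of_pos (x := Real.exp (φ u) / Z / ρ u) (by positivity)
      rw [Real.log_div (by positivity) h0.ne', Real.log_div (by positivity) hZ.ne', Real.log_exp] at h1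
      have h2 := mul_le_mul_of_nonneg_right h1 h0.le
      have h3 : (Real.exp (φ u) / Z / ρ u - 1) * ρ u = Real.exp (φ u) / Z - ρ u := by
        field_simp
      linarith
  rw [integral_sub (hexp.div_const Z) hρ.1, integral_div, ← hZdef, div_self hZ.ne', hρ.2.2, sub_self,
    integral_sub (f := fun u => φ u * ρ u - Real.log Z * ρ u) (hφρ.sub (hρ.1.const_mul _)) hρi,
    integral_sub hφρ (hρ.1.const_mul _),
    integral_const_mul, hρ.2.2] at hle
  simp only [entropy]
  linarith

/-- The exponent of the Gibbs density. -/
noncomputable def gibbsExponent (M : ControlledChain d ℓ) (lam : ℝ) (y : Fin d → ℝ) (i : Fin d)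
    (u : EuclideanSpace ℝ (Fin ℓ)) : ℝ :=
  1 / lam * (M.f 0 i u + M.q u i ⬝ᵥ y)

/-- The normalizing constant of the Gibbs density. -/
noncomputable def gibbsNorm (M : ControlledChain d ℓ) (lam : ℝ) (y : Fin d → ℝ) (i : Fin d) : ℝ :=
  ∫ u in M.U, Real.exp (M.gibbsExponent lam y i u)

theorem gibbs_eq (lam : ℝ) (y : Fin d → ℝ) (i : Fin d) (u : EuclideanSpace ℝ (Fin ℓ)) :
    M.gibbs lam y i u = Real.exp (M.gibbsExponent lam y i u) / M.gibbsNorm lam y i := rfl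

theorem continuousOn_gibbsExponent_prod (hlip : M.LipschitzCondition) (lam : ℝ) (i : Fin d) :
    ContinuousOn (fun p : (Fin d → ℝ) × EuclideanSpace ℝ (Fin ℓ) => M.gibbsExponent lam p.1 i p.2)
      (Set.univ ×ˢ M.U) := by
  have hmaps : Set.MapsTo Prod.snd ((Set.univ : Set (Fin d → ℝ)) ×ˢ M.U) M.U := fun p hp => hp.2
  refine continuousOn_const.mul (((hlip.continuousOn_f le_rfl i).comp continuousOn_snd hmaps).add ?_)
  refine continuousOn_finsetSum _ fun j _ => ContinuousOn.mul ?_ ?_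
  · exact (hlip.continuousOn_q i j).comp continuousOn_snd hmaps
  · exact ((continuous_apply j).comp continuous_fst).continuousOn

theorem continuousOn_gibbsExponent (hlip : M.LipschitzCondition) (lam : ℝ) (y : Fin d → ℝ) (i : Fin d) :
    ContinuousOn (M.gibbsExponent lam y i) M.U :=
  (continuousOn_gibbsExponent_prod hlip lam i).comp (f := fun u => (y, u))
    (continuous_const.prodMk continuous_id).continuousOn fun _ hu => ⟨trivial, hu⟩

theorem gibbsNorm_pos (hM : M.IsAdmissible) (hlip : M.LipschitzCondition) (lam : ℝ) (y : Fin d → ℝ)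
    (i : Fin d) : 0 < M.gibbsNorm lam y i := by
  have : NeZero (volume.restrict M.U) := ⟨by
    simpa [Measure.restrict_eq_zero] using hM.volume_pos.ne'⟩
  exact integral_exp_pos ((Real.continuous_exp.comp_continuousOn
    (continuousOn_gibbsExponent hlip lam y i)).integrableOn_compact hM.isCompact)

theorem gibbs_pos (hM : M.IsAdmissible) (hlip : M.LipschitzCondition) (lam : ℝ) (y : Fin d → ℝ)
    (i : Fin d) (u : EuclideanSpace ℝ (Fin ℓ)) : 0 < M.gibbs lam y i u :=
  div_pos (Real.exp_pos _) (gibbsNorm_pos hM hlip lam y i)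

theorem log_gibbs (hM : M.IsAdmissible) (hlip : M.LipschitzCondition) (lam : ℝ) (y : Fin d → ℝ)
    (i : Fin d) (u : EuclideanSpace ℝ (Fin ℓ)) : Real.log (M.gibbs lam y i u) =
      M.gibbsExponent lam y i u - Real.log (M.gibbsNorm lam y i) := by
  rw [gibbs_eq, Real.log_div (Real.exp_pos _).ne' (gibbsNorm_pos hM hlip lam y i).ne', Real.log_exp]

theorem continuous_gibbsNorm (hM : M.IsAdmissible) (hlip : M.LipschitzCondition) (lam : ℝ)
    (i : Fin d) : Continuous fun y => M.gibbsNorm lam y i :=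
  continuous_setIntegral_of_continuousOn hM.isCompact
    (Real.continuous_exp.comp_continuousOn (continuousOn_gibbsExponent_prod hlip lam i))

theorem continuousOn_gibbs_prod (hM : M.IsAdmissible) (hlip : M.LipschitzCondition) (lam : ℝ)
    (i : Fin d) : ContinuousOn
      (fun p : (Fin d → ℝ) × EuclideanSpace ℝ (Fin ℓ) => M.gibbs lam p.1 i p.2) (Set.univ ×ˢ M.U) :=
  (Real.continuous_exp.comp_continuousOn (continuousOn_gibbsExponent_prod hlip lam i)).div
    ((continuous_gibbsNorm hM hlip lam i).comp continuous_fst).continuousOn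
    fun p _ => (gibbsNorm_pos hM hlip lam p.1 i).ne'

theorem continuousOn_gibbs (hlip : M.LipschitzCondition) (lam : ℝ)
    (y : Fin d → ℝ) (i : Fin d) : ContinuousOn (M.gibbs lam y i) M.U :=
  (Real.continuous_exp.comp_continuousOn (continuousOn_gibbsExponent hlip lam y i)).div_const _

theorem isRegular_gibbs (hM : M.IsAdmissible) (hlip : M.LipschitzCondition) (lam : ℝ)
    (y : Fin d → ℝ) : M.IsRegular (M.gibbs lam y) := by
  intro i
  have hc := continuousOn_gibbs hlip lam y i
  refine ⟨⟨hc.integrableOn_compact hM.isCompact, fun u _ => (gibbs_pos hM hlip lam y i u).le, ?_⟩, ?_⟩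
  · simp_rw [gibbs_eq]
    rw [integral_div]
    exact div_self (gibbsNorm_pos hM hlip lam y i).ne'
  · exact ((hc.log fun u _ => (gibbs_pos hM hlip lam y i u).ne').mul hc).integrableOn_compact
      hM.isCompact

/-- This is the equality case of `integral_mul_add_entropy_le`. -/
theorem entropy_gibbs (hM : M.IsAdmissible) (hlip : M.LipschitzCondition) (lam : ℝ)
    (y : Fin d → ℝ) (i : Fin d) : M.entropy (M.gibbs lam y i) =
      Real.log (M.gibbsNorm lam y i) - ∫ u in M.U, M.gibbsExponent lam y i u * M.gibbs lam y i u := by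
  have hd := (isRegular_gibbs hM hlip lam y i).1
  simp_rw [entropy, log_gibbs hM hlip, sub_mul]
  rw [integral_sub (integrableOn_continuousOn_mul_density hM hd
    (continuousOn_gibbsExponent hlip lam y i)) (hd.1.const_mul _), integral_const_mul, hd.2.2]
  ring

theorem continuous_entropy_gibbs (hM : M.IsAdmissible) (hlip : M.LipschitzCondition) (lam : ℝ)
    (i : Fin d) : Continuous fun y => M.entropy (M.gibbs lam y i) := by
  simp_rw [entropy_gibbs hM hlip]
  refine ((continuous_gibbsNorm hM hlip lam i).log fun y => (gibbsNorm_pos hM hlip lam y i).ne').sub ?_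
  exact continuous_setIntegral_of_continuousOn hM.isCompact
    ((continuousOn_gibbsExponent_prod hlip lam i).mul (continuousOn_gibbs_prod hM hlip lam i))

theorem continuous_setIntegral_mul_gibbs (hM : M.IsAdmissible) (hlip : M.LipschitzCondition) (lam : ℝ)
    (i : Fin d) {g : EuclideanSpace ℝ (Fin ℓ) → ℝ} (hg : ContinuousOn g M.U) :
    Continuous fun y => ∫ u in M.U, g u * M.gibbs lam y i u :=
  continuous_setIntegral_of_continuousOn hM.isCompact
    ((hg.comp continuousOn_snd fun _ hp => hp.2).mul (continuousOn_gibbs_prod hM hlip lam i))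

theorem continuous_relaxedRate_gibbs (hM : M.IsAdmissible) (hlip : M.LipschitzCondition) (lam : ℝ) :
    Continuous fun y => M.relaxedRate (M.gibbs lam y) :=
  continuous_pi fun i => continuous_pi fun j =>
    continuous_setIntegral_mul_gibbs hM hlip lam i (hlip.continuousOn_q i j)

theorem continuous_runningReward_gibbs (hM : M.IsAdmissible) (hlip : M.LipschitzCondition) (lam : ℝ)
    {s : ℝ} (hs : 0 ≤ s) (k : Fin d) :
    Continuous fun y => M.runningReward lam (M.gibbs lam y) s k :=
  (continuous_setIntegral_mul_gibbs hM hlip lam k (hlip.continuousOn_f hs k)).add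
    (continuous_const.mul (continuous_entropy_gibbs hM hlip lam k))

/-- Dominated convergence in the time integral: transition probabilities are at most one, rewards
are below `F`, and the entropies, being continuous in `y`, are bounded near `y₀`. -/
theorem continuous_psi (hM : M.IsAdmissible) (hint : M.IntegrabilityCondition)
    (hlip : M.LipschitzCondition)
    (hf : ∀ i, ∀ u ∈ M.U, ContinuousOn (fun t => M.f t i u) (Set.Ici 0))
    (hδ : ContinuousOn M.δ (Set.Ici 0)) {lam : ℝ} (hlam : 0 < lam) : Continuous (M.psi lam) := by
  obtain ⟨F, hF, hFb⟩ := exists_integrableOn_bound hM hint hlip hf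
  have hreg := isRegular_gibbs hM hlip lam
  refine continuous_pi fun i => continuous_iff_continuousAt.2 fun y₀ => ?_
  simp_rw [psi, value_eq_integral hM hint hlip hf hδ hlam (hreg _)]
  refine continuousAt_of_dominated (bound := fun s => ∑ k, (F s + lam * M.δ s *
    (|M.entropy (M.gibbs lam y₀ k)| + 1))) ?_ ?_ ?_ ?_
  · refine Eventually.of_forall fun y => ?_
    refine (integrable_finsetSum _ fun k _ => integrableOn_exp_smul_mul
      (isRateMatrix_relaxedRate hM hlip (hreg y)) i k
      (integrableOn_runningReward hM hint hlip hf hδ hlam (hreg y) k)).aestronglyMeasurable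
  · have h1 : ∀ k, ∀ᶠ y in 𝓝 y₀, |M.entropy (M.gibbs lam y k)| <
        |M.entropy (M.gibbs lam y₀ k)| + 1 := fun k =>
      (continuous_entropy_gibbs hM hlip lam k).abs.continuousAt.eventually_lt_const (lt_add_one _)
    filter_upwards [eventually_all.2 h1] with y hy
    filter_upwards [hFb, ae_restrict_mem measurableSet_Ioi] with s hs hs0
    have hs0' := (Set.mem_Ioi.1 hs0).le
    have hδs := hM.discount_nonneg s hs0'
    refine norm_sum_le_of_le _ fun k _ => ?_
    rw [norm_mul, Real.norm_eq_abs, Real.norm_eq_abs]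
    refine (mul_le_of_le_one_left (abs_nonneg _) (abs_exp_smul_apply_le_one
      (isRateMatrix_relaxedRate hM hlip (hreg y)) i k hs0')).trans ?_
    refine (abs_runningReward_le hM hlam (hreg y) hs0' (hs.2 k)).trans ?_
    gcongr
    exact (hy k).le
  · exact integrable_finsetSum _ fun k _ =>
      hF.add (((integrableOn_discount hM hint hδ).const_mul lam).mul_const _)
  · filter_upwards [ae_restrict_mem measurableSet_Ioi] with s hs
    refine Continuous.continuousAt (continuous_finsetSum _ fun k _ => Continuous.mul ?_ ?_)
    · exact (continuous_apply_apply i k).comp (continuous_exp_matrix.comp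
        ((continuous_relaxedRate_gibbs hM hlip lam).const_smul s))
    · exact continuous_runningReward_gibbs hM hlip lam (Set.mem_Ioi.1 hs).le k

theorem exists_abs_psi_le (hM : M.IsAdmissible) (hint : M.IntegrabilityCondition)
    (hlip : M.LipschitzCondition)
    (hf : ∀ i, ∀ u ∈ M.U, ContinuousOn (fun t => M.f t i u) (Set.Ici 0))
    (hδ : ContinuousOn M.δ (Set.Ici 0)) {lam : ℝ} (hlam : 0 < lam) :
    ∃ A B : ℝ, ∀ y i, |M.psi lam y i| ≤ ∑ k, (A + B * |M.entropy (M.gibbs lam y k)|) := by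
  obtain ⟨F, hF, hFb⟩ := exists_integrableOn_bound hM hint hlip hf
  have hδi := integrableOn_discount hM hint hδ
  refine ⟨∫ s in Set.Ioi (0 : ℝ), F s, lam * ∫ s in Set.Ioi (0 : ℝ), M.δ s, fun y i => ?_⟩
  have hreg := isRegular_gibbs hM hlip lam y
  have hi : ∀ k, IntegrableOn (fun s => F s + lam * M.δ s * |M.entropy (M.gibbs lam y k)|)
      (Set.Ioi 0) := fun k => hF.add ((hδi.const_mul lam).mul_const _)
  rw [psi, value_eq_integral hM hint hlip hf hδ hlam hreg, ← Real.norm_eq_abs]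
  calc _ ≤ ∫ s in Set.Ioi (0 : ℝ), ∑ k, (F s + lam * M.δ s * |M.entropy (M.gibbs lam y k)|) := by
        refine norm_integral_le_of_norm_le (integrable_finsetSum _ fun k _ => hi k) ?_
        filter_upwards [hFb, ae_restrict_mem measurableSet_Ioi] with s hs hs0
        have hs0' := (Set.mem_Ioi.1 hs0).le
        refine norm_sum_le_of_le _ fun k _ => ?_
        rw [norm_mul, Real.norm_eq_abs, Real.norm_eq_abs]
        refine (mul_le_of_le_one_left (abs_nonneg _) (abs_exp_smul_apply_le_one
          (isRateMatrix_relaxedRate hM hlip hreg) i k hs0')).trans ?_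
        exact abs_runningReward_le hM hlam hreg hs0' (hs.2 k)
    _ = _ := by
        rw [integral_finsetSum _ fun k _ => hi k]
        refine Finset.sum_congr rfl fun k _ => ?_
        rw [integral_add hF ((hδi.const_mul lam).mul_const _), integral_mul_const, integral_const_mul]

/-- The bound `κ ≥ 1` serves only to keep the radius `θ / (κ (1 + ‖y‖))` below `θ`, where the volume
estimate applies. -/
theorem exists_abs_gibbsExponent_sub_le (hlip : M.LipschitzCondition) {lam : ℝ} (hlam : 0 < lam) :
    ∃ κ ≥ 1, ∀ y i, ∀ u ∈ M.U, ∀ v ∈ M.U,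
      |M.gibbsExponent lam y i u - M.gibbsExponent lam y i v| ≤ κ * (1 + ‖y‖) * ‖u - v‖ := by
  obtain ⟨Θ, hΘ⟩ := hlip
  refine ⟨1 + 1 / lam * (|Θ| * (1 + d)), by
    have : 0 ≤ 1 / lam * (|Θ| * (1 + d)) := by positivity
    linarith, fun y i u hu v hv => ?_⟩
  have h0 := hΘ 0 le_rfl i u hu v hv
  have hle : Θ * ‖u - v‖ ≤ |Θ| * ‖u - v‖ := by gcongr; exact le_abs_self Θ
  have h1 : |M.f 0 i u - M.f 0 i v| ≤ |Θ| * ‖u - v‖ :=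
    (le_add_of_nonneg_right (norm_nonneg _)).trans (h0.trans hle)
  have h2 : ∀ j, |M.q u i j - M.q v i j| ≤ |Θ| * ‖u - v‖ := fun j =>
    (PiLp.norm_apply_le (WithLp.toLp 2 (M.q u i - M.q v i)) j).trans
      ((le_add_of_nonneg_left (abs_nonneg _)).trans (h0.trans hle))
  have h3 : |(M.q u i - M.q v i) ⬝ᵥ y| ≤ d * (|Θ| * ‖u - v‖ * ‖y‖) := by
    calc |(M.q u i - M.q v i) ⬝ᵥ y| ≤ ∑ _j : Fin d, |Θ| * ‖u - v‖ * ‖y‖ := by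
          refine (Finset.abs_sum_le_sum_abs _ _).trans (Finset.sum_le_sum fun j _ => ?_)
          rw [abs_mul]
          exact mul_le_mul (h2 j) (norm_le_pi_norm y j) (abs_nonneg _) (by positivity)
      _ = _ := by simp
  have h4 : M.gibbsExponent lam y i u - M.gibbsExponent lam y i v =
      1 / lam * ((M.f 0 i u - M.f 0 i v) + (M.q u i - M.q v i) ⬝ᵥ y) := by
    rw [sub_dotProduct, gibbsExponent, gibbsExponent]; ring
  rw [h4, abs_mul, abs_of_pos (by positivity : 0 < 1 / lam)]
  calc 1 / lam * |(M.f 0 i u - M.f 0 i v) + (M.q u i - M.q v i) ⬝ᵥ y|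
      ≤ 1 / lam * (|Θ| * ‖u - v‖ + d * (|Θ| * ‖u - v‖ * ‖y‖)) := by
        gcongr; exact (abs_add_le _ _).trans (add_le_add h1 h3)
    _ ≤ 1 / lam * ((|Θ| * (1 + d)) * (1 + ‖y‖) * ‖u - v‖) := by
        gcongr
        have ha : 0 ≤ |Θ| * ‖u - v‖ := by positivity
        have hb : 0 ≤ |Θ| * ‖u - v‖ * ‖y‖ := by positivity
        have hc : 0 ≤ (d : ℝ) * (|Θ| * ‖u - v‖) := by positivity
        nlinarith
    _ ≤ (1 + 1 / lam * (|Θ| * (1 + d))) * (1 + ‖y‖) * ‖u - v‖ := by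
        have : 0 ≤ (1 + ‖y‖) * ‖u - v‖ := by positivity
        nlinarith

/-- Under the cone condition the entropy of the Gibbs density grows at most logarithmically. -/
theorem exists_abs_entropy_gibbs_le (hM : M.IsAdmissible) (hlip : M.LipschitzCondition)
    (hcone : UniformConeCondition M.U) {lam : ℝ} (hlam : 0 < lam) :
    ∃ A : ℝ, ∀ y i, |M.entropy (M.gibbs lam y i)| ≤ A + ℓ * Real.log (1 + ‖y‖) := by
  obtain ⟨θ, hθ, c, hc, hvol⟩ := hcone.exists_le_volume hM.isCompact.measure_lt_top.ne
  obtain ⟨κ, hκ, hLip⟩ := exists_abs_gibbsExponent_sub_le hlip hlam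
  have hU := hM.isCompact.measurableSet
  set V := volume.real M.U
  refine ⟨|Real.log V| + |Real.log (c * (θ / κ) ^ ℓ) - θ|, fun y i => ?_⟩
  have hlog : 0 ≤ Real.log (1 + ‖y‖) := Real.log_nonneg (by linarith [norm_nonneg y])
  have hreg := isRegular_gibbs hM hlip lam y i
  have hφ := continuousOn_gibbsExponent hlip lam y i
  set φ := M.gibbsExponent lam y i
  -- The variational inequality with exponent zero: no density has more entropy than the uniform
  -- one.
  have hupper : M.entropy (M.gibbs lam y i) ≤ Real.log V := by
    have := integral_mul_add_entropy_le hM hreg.1 hreg.2 (φ := fun _ => 0) continuousOn_const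
    simpa [V] using this
  have hlower : Real.log (c * (θ / κ) ^ ℓ) - θ - ℓ * Real.log (1 + ‖y‖) ≤
      M.entropy (M.gibbs lam y i) := by
    -- The entropy is `log Z` minus the mean of `φ`, and this mean is at most `φ u₀`. On the ball of
    -- radius `θ / K` about `u₀` the exponent drops by at most `θ`, so `Z` is at least `exp (φ u₀ -
    -- θ)` times the volume of that ball within `U`. The maximum cancels, and the volume leaves `-ℓ
    -- log (1 + ‖y‖)`.
    obtain ⟨u₀, hu₀, hmax⟩ := hM.isCompact.exists_isMaxOn hM.nonempty hφ
    have hmean : ∫ u in M.U, φ u * M.gibbs lam y i u ≤ φ u₀ := by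
      calc _ ≤ ∫ u in M.U, φ u₀ * M.gibbs lam y i u :=
            setIntegral_mono_on (integrableOn_continuousOn_mul_density hM hreg.1 hφ)
              (hreg.1.1.const_mul _) hU fun u hu =>
                mul_le_mul_of_nonneg_right (hmax hu) (hreg.1.2.1 u hu)
        _ = φ u₀ := by rw [integral_const_mul, hreg.1.2.2, mul_one]
    set K := κ * (1 + ‖y‖)
    have hK1 : 1 ≤ K := by
      have := norm_nonneg y
      nlinarith
    have hK : 0 < K := by linarith
    have hexp : IntegrableOn (fun u => Real.exp (φ u)) M.U :=
      (Real.continuous_exp.comp_continuousOn hφ).integrableOn_compact hM.isCompact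
    have hr : 0 < θ / K := by positivity
    have hZ : Real.exp (φ u₀ - θ) * (c * (θ / K) ^ ℓ) ≤ M.gibbsNorm lam y i := by
      calc _ ≤ Real.exp (φ u₀ - θ) * volume.real (M.U ∩ Metric.ball u₀ (θ / K)) := by
            gcongr
            exact hvol u₀ hu₀ _ hr (div_le_self hθ.le hK1)
        _ = ∫ _ in M.U ∩ Metric.ball u₀ (θ / K), Real.exp (φ u₀ - θ) := by
            rw [setIntegral_const, smul_eq_mul, mul_comm]
        _ ≤ ∫ u in M.U ∩ Metric.ball u₀ (θ / K), Real.exp (φ u) := by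
            refine setIntegral_mono_on (integrableOn_const (measure_ne_top_of_subset
              Set.inter_subset_left hM.isCompact.measure_lt_top.ne))
              (hexp.mono_set Set.inter_subset_left) (hU.inter measurableSet_ball) fun u hu => ?_
            gcongr
            have h1 := (abs_le.1 (hLip y i u hu.1 u₀ hu₀)).1
            have h2 : ‖u - u₀‖ ≤ θ / K := by
              have := hu.2
              rw [Metric.mem_ball, dist_eq_norm] at this
              exact this.le
            have h3 : K * ‖u - u₀‖ ≤ θ := by
              rw [le_div_iff₀ hK] at h2
              linarith
            linarith
        _ ≤ _ := setIntegral_mono_set hexp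
            (Eventually.of_forall fun u => (Real.exp_pos _).le) Set.inter_subset_left.eventuallyLE
    have hlogZ := Real.log_le_log (by positivity) hZ
    have hsplit : c * (θ / K) ^ ℓ = c * (θ / κ) ^ ℓ / (1 + ‖y‖) ^ ℓ := by
      simp only [K]; rw [← div_div, div_pow (θ / κ), mul_div_assoc]
    rw [Real.log_mul (Real.exp_pos _).ne' (by positivity), Real.log_exp, hsplit,
      Real.log_div (by positivity) (by positivity), Real.log_pow] at hlogZ
    rw [entropy_gibbs hM hlip]
    linarith
  rw [abs_le]
  have h1 := le_abs_self (Real.log V)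
  have h2 := neg_abs_le (Real.log (c * (θ / κ) ^ ℓ) - θ)
  have h3 : 0 ≤ ℓ * Real.log (1 + ‖y‖) := by positivity
  have h4 := abs_nonneg (Real.log V)
  have h5 := abs_nonneg (Real.log (c * (θ / κ) ^ ℓ) - θ)
  constructor <;> linarith

theorem isLittleO_psi (hM : M.IsAdmissible) (hint : M.IntegrabilityCondition)
    (hlip : M.LipschitzCondition) (hcone : UniformConeCondition M.U)
    (hf : ∀ i, ∀ u ∈ M.U, ContinuousOn (fun t => M.f t i u) (Set.Ici 0))
    (hδ : ContinuousOn M.δ (Set.Ici 0)) {lam : ℝ} (hlam : 0 < lam) :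
    M.psi lam =o[Bornology.cobounded _] fun y => y := by
  obtain ⟨A, B, hAB⟩ := exists_abs_psi_le hM hint hlip hf hδ hlam
  obtain ⟨C, hC⟩ := exists_abs_entropy_gibbs_le hM hlip hcone hlam
  have hbound : ∀ y, ‖M.psi lam y‖ ≤ d * (|A| + |B| * C) + d * |B| * ℓ * Real.log (1 + ‖y‖) := by
    intro y
    have hsum : ∀ i, ‖M.psi lam y i‖ ≤ d * (|A| + |B| * C) + d * |B| * ℓ * Real.log (1 + ‖y‖) := by
      intro i
      calc ‖M.psi lam y i‖ ≤ ∑ k, (A + B * |M.entropy (M.gibbs lam y k)|) := hAB y i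
        _ ≤ ∑ _k : Fin d, (|A| + |B| * (C + ℓ * Real.log (1 + ‖y‖))) := by
            refine Finset.sum_le_sum fun k _ => add_le_add (le_abs_self A) ?_
            exact mul_le_mul (le_abs_self B) (hC y k) (abs_nonneg _) (abs_nonneg _)
        _ = _ := by
            rw [Finset.sum_const, Finset.card_univ, Fintype.card_fin, nsmul_eq_mul]; ring
    rcases isEmpty_or_nonempty (Fin d) with h | h
    · have hd : d = 0 := Fintype.card_eq_zero_iff.2 h |>.symm ▸ (Fintype.card_fin d).symm
      rw [Subsingleton.elim (M.psi lam y) 0, norm_zero]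
      simp [hd]
    · exact (pi_norm_le_iff_of_nonempty _).2 hsum
  have hlim : Tendsto (fun y : Fin d → ℝ => ‖y‖) (Bornology.cobounded _) atTop :=
    tendsto_norm_cobounded_atTop
  have h1 : (fun t : ℝ => d * (|A| + |B| * C) + d * |B| * ℓ * Real.log (1 + t)) =o[atTop]
      fun t : ℝ => t := by
    refine (Asymptotics.isLittleO_const_id_atTop _).add (Asymptotics.IsLittleO.const_mul_left ?_ _)
    have h2 := Real.isLittleO_log_id_atTop.comp_tendsto (tendsto_atTop_add_const_left atTop (1 : ℝ) tendsto_id)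
    refine h2.trans_isBigO ?_
    exact (Asymptotics.isLittleO_const_id_atTop (1 : ℝ)).isBigO.add (Asymptotics.isBigO_refl _ _)
  refine Asymptotics.IsBigO.trans_isLittleO (Asymptotics.isBigO_of_le _ fun y => ?_)
    (h1.comp_tendsto hlim).norm_right |>.trans_isBigO ?_
  · exact (hbound y).trans (le_abs_self _)
  · exact Asymptotics.isBigO_of_le _ fun y => by simp

/-- The Gibbs control of a fixed point of `psi` is an equilibrium. -/
theorem isRelaxedEquilibrium_gibbs (hM : M.IsAdmissible) (hint : M.IntegrabilityCondition)
    (hlip : M.LipschitzCondition)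
    (hf : ∀ i, ∀ u ∈ M.U, ContinuousOn (fun t => M.f t i u) (Set.Ici 0))
    (hδ : ContinuousOn M.δ (Set.Ici 0)) {lam : ℝ} (hlam : 0 < lam) {y : Fin d → ℝ}
    (hy : M.psi lam y = y) : M.IsRelaxedEquilibrium lam (M.gibbs lam y) := by
  have hreg := isRegular_gibbs hM hlip lam y
  refine ⟨hreg, fun π' hπ' i => ?_⟩
  have hlim := tendsto_concatValue_sub_value_div hM hint hlip hf hδ hlam hπ' hreg i
  have hE := (continuous_coe_real_ereal.tendsto _).comp hlim
  refine hE.limsup_eq.trans_le ?_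
  rw [← EReal.coe_zero, EReal.coe_le_coe_iff]
  have hv : ∀ l, M.value lam (M.gibbs lam y) l = y l := fun l => congrFun hy l
  have hφ := continuousOn_gibbsExponent hlip lam y i
  -- At time zero the discount is one, so reward and drift together are `λ` times the functional
  -- that the Gibbs density maximizes.
  have hkey : ∀ π : Fin d → EuclideanSpace ℝ (Fin ℓ) → ℝ, M.IsRegular π →
      M.runningReward lam π 0 i + ∑ l, M.relaxedRate π i l * y l =
        lam * ((∫ u in M.U, M.gibbsExponent lam y i u * π i u) + M.entropy (π i)) := by
    intro π hπ
    have h1 : ∑ l, M.relaxedRate π i l * y l = ∫ u in M.U, (M.q u i ⬝ᵥ y) * π i u := by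
      simp_rw [relaxedRate, ← integral_mul_const]
      rw [← integral_finsetSum _ fun l _ => (integrableOn_continuousOn_mul_density hM (hπ i).1
        (hlip.continuousOn_q i l)).mul_const _]
      refine integral_congr_ae (Eventually.of_forall fun u => ?_)
      simp only [dotProduct, Finset.sum_mul]
      exact Finset.sum_congr rfl fun l _ => by ring
    have h2 : ∫ u in M.U, M.gibbsExponent lam y i u * π i u =
        1 / lam * ((∫ u in M.U, M.f 0 i u * π i u) + ∫ u in M.U, (M.q u i ⬝ᵥ y) * π i u) := by
      rw [← integral_add, ← integral_const_mul]
      · refine integral_congr_ae (Eventually.of_forall fun u => ?_)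
        simp only [gibbsExponent]; ring
      · exact integrableOn_continuousOn_mul_density hM (hπ i).1 (hlip.continuousOn_f le_rfl i)
      · exact integrableOn_continuousOn_mul_density hM (hπ i).1 (continuousOn_finsetSum _ fun j _ =>
          (hlip.continuousOn_q i j).mul continuousOn_const)
    rw [h1, h2, runningReward, relaxedReward, hM.discount_zero]
    field_simp
    ring
  have h1 := hkey π' hπ'
  have h2 := hkey _ hreg
  -- The deviating control contributes at most `λ log Z`; the Gibbs control contributes exactly
  -- that.
  have h3 := mul_le_mul_of_nonneg_left
    (integral_mul_add_entropy_le hM (hπ' i).1 (hπ' i).2 hφ) hlam.le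
  have h4 := entropy_gibbs hM hlip lam y i
  rw [h4] at h2
  simp_rw [hv, sub_mul, Finset.sum_sub_distrib]
  have h5 : M.gibbsNorm lam y i = ∫ u in M.U, Real.exp (M.gibbsExponent lam y i u) := rfl
  rw [← h5] at h3
  linarith

end ControlledChain

theorem mainTheorem3 {d ℓ : ℕ} (hℓ : 1 ≤ ℓ) (M : ControlledChain d ℓ)
    (hM : M.IsAdmissible)
    (hint : M.IntegrabilityCondition)
    (hlip : M.LipschitzCondition)
    (hcone : UniformConeCondition M.U)
    (hf : ∀ i, ∀ u ∈ M.U, ContinuousOn (fun t => M.f t i u) (Set.Ici 0))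
    (hδ : ContinuousOn M.δ (Set.Ici 0))
    (lam : ℝ) (hlam : 0 < lam) :
    (∃ y : Fin d → ℝ, M.psi lam y = y) ∧
      ∀ y : Fin d → ℝ, M.psi lam y = y → M.IsRelaxedEquilibrium lam (M.gibbs lam y) := by
  exact ⟨exists_fixedPoint_of_isLittleO (ControlledChain.continuous_psi hM hint hlip hf hδ hlam)
    (ControlledChain.isLittleO_psi hM hint hlip hcone hf hδ hlam),
    fun _ hy => ControlledChain.isRelaxedEquilibrium_gibbs hM hint hlip hf hδ hlam hy⟩
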